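/- **Setting.** A coupled system consists of the following data. Travelers form a continuum of mass $1$ and choose among finitely many routes $r$; each route is a finite set of road links, and each route is assigned a charging point, which is connected to a bus $i(r)$. Let $\mathbf A_{\ell r}=1$ if route $r$ contains link $\ell$ and $0$ otherwise. For a flow $\mathbf x$, the travel cost of route $r$ is $c^{\mathrm{tr}}_r(\mathbf x)=\sum_{\ell\in r}\left(\alpha_\ell(\mathbf A\mathbf x)_\ell+\beta_\ell\right)$ with $\alpha_\ell>0$, $\beta_\ell\ge 0$. The power network is radial (a tree of buses); each of finitely many flow limits $\ell_{\mathrm P}$ says that the flow on a given line in a given direction is at most $\bar f_{\ell_{\mathrm P}}>0$, and $\mathbf H$ is the shift factor matrix. Given $\mathbf x$, the loads are $d_i(\mathbf x)=\rho\sum_{r:\,i(r)=i}x_r$ with $\rho>0$, and the economic dispatch is $$\Phi_{\mathrm P}(\mathbf x)=\min_{\mathbf g,\mathbf p}\ \sum_i\left(\tfrac12Q_ig_i^2+\mu_ig_i\right)\quad\text{s.t.}\quad \mathbf g-\mathbf d(\mathbf x)=\mathbf p,\ \ \mathbf 1^\top\mathbf p=0,\ \ \mathbf H\mathbf p\le\bar{\mathbf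 f},\qquad Q_i>0 .$$ The locational marginal prices $\boldsymbol\lambda$ are the multipliers of $\mathbf g-\mathbf d(\mathbf x)=\mathbf p$. A generalized user equilibrium (GUE) is a pair $(\mathbf x^\star,\boldsymbol\lambda^\star)$ with $\mathbf x^\star\ge0$, $\mathbf 1^\top\mathbf x^\star=1$, such that every route with $x^\star_r>0$ minimizes $c^{\mathrm{tr}}_r(\mathbf x^\star)+\rho\lambda^\star_{i(r)}$ over all routes, and $\boldsymbol\lambda^\star$ is a vector of prices for $\mathbf x^\star$. GUEs are the solutions of the convex program that minimizes $\sum_i(\frac12Q_ig_i^2+\mu_ig_i)+\sum_\ell(\frac12\alpha_\ell(\mathbf A\mathbf x)_\ell^2+\beta_\ell(\mathbf A\mathbf x)_\ell)$ over $(\mathbf x,\mathbf g,\mathbf p)$ subject to the constraints of the dispatch and $\mathbf x\ge0$, $\mathbf 1^\top\mathbf x=1$. A critical region is the set of all $(\boldsymbol\alpha,\bar{\mathbf f})$ with $\boldsymbol\alpha\ge0$, $\bar{\mathbf f}>0$ at which this program has a unique solution and the solution has a given set of binding inequality constraints. We assume that $(\boldsymbol\alpha,\bar{\mathbf f})$ lies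 in the interior of a critical region. Let $\Phi_{\mathrm T}=\sum_rx_r^\star c_r^{\mathrm{tr}}(\mathbf x^\star)$ and $\Phi_{\mathrm P}=\Phi_{\mathrm P}(\mathbf x^\star)$, as functions of $(\boldsymbol\alpha,\bar{\mathbf f})$. For $s\in\{\mathrm T,\mathrm P\}$, type T-$s$ Braess' paradox (BP) occurs when perturbing the road link $\ell$ if $\partial\Phi_s/\partial\alpha_\ell<0$; type P-$s$ BP occurs when perturbing the flow limit $\ell_{\mathrm P}$ if $\partial\Phi_s/\partial\bar f_{\ell_{\mathrm P}}>0$ (the derivatives being required to exist). **Aggregation.** A line is congested if one of its flow limits binds at the GUE. The subnetworks $k=1,\dots,K$ are the groups of buses connected by uncongested lines, and the route bundle $\mathcal P^k$ is the set of routes $r$ with $x^\star_r>0$ and $i(r)$ in subnetwork $k$. We assume $\mathcal P^k\ne\emptyset$ for all $k$, and (A2') that no two route bundles share links. Put $\hat x^\star_k=\sum_{r\in\mathcal P^k}x^\star_r$; let $\hat\lambda^\star_k$ be the common price in subnetwork $k$, $\hat f_k$ the net power flow out of subnetwork $k$ (a signed sum of the limits $\bar f$ of the congested lines), $\widehat Q_k=\left(\sum_{i\in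 k}Q_i^{-1}\right)^{-1}$ and $\hat\mu_k=\widehat Q_k\sum_{i\in k}Q_i^{-1}\mu_i$. The coefficients $\hat\alpha_{k,k'},\hat\beta_k$ are those with $\hat c_k=\sum_{k'}\hat\alpha_{k,k'}\hat x_{k'}+\hat\beta_k$ whenever flows on the routes with $x_r^\star>0$ give all routes of each bundle $\mathcal P^k$ the same travel cost $\hat c_k$ and give the bundles the totals $\hat x_k$. The aggregated system has the bundles as routes with travel costs $\hat c_k$, and the subnetworks as buses with generation $\hat g_k=\rho\hat x_k+\hat f_k$, generation cost $\frac12\widehat Q_k\hat g_k^2+\hat\mu_k\hat g_k$ and price $\widehat Q_k\hat g_k+\hat\mu_k$; at its equilibrium, its social costs $\Phi_{\mathrm T}=\sum_k\hat x_k\hat c_k$ and $\Phi_{\mathrm P}=\sum_k(\frac12\widehat Q_k\hat g_k^2+\hat\mu_k\hat g_k)$ are functions of $(\hat\alpha_{k,k'})$ and $(\hat\beta_k)$. Type T-$s$ aggregated TBP (ATBP) occurs with respect to $\mathcal P^k$ if $\partial\Phi_s/\partial\hat\alpha_{k,k'}<0$ for some $k'$ or $\partial\Phi_s/\partial\hat\beta_k<0$;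 strict non-occurrence means that all these derivatives are strictly positive. For a link $\ell$ of $\mathcal P^k$, classical BP occurs in $\mathcal P^k$ when perturbing $\ell$ if, in the transportation network that consists of the routes of $\mathcal P^k$ with fixed net flow $\hat x^\star_k$ and no charging costs, the total travel cost at the user equilibrium has a strictly negative partial derivative in $\alpha_\ell$; strict non-occurrence means that this derivative is strictly positive. Put $$\omega_k=\frac1{\hat\alpha_{k,k}+\rho^2\widehat Q_k},\qquad \tilde\omega_k=\frac{\omega_k}{\sum_{k'}\omega_{k'}},\qquad \hat\psi_k=\omega_k\Big(2\hat\alpha_{k,k}\hat x^\star_k+\hat\beta_k-\sum_{k'}\tilde\omega_{k'}\big(2\hat\alpha_{k',k'}\hat x^\star_{k'}+\hat\beta_{k'}\big)\Big),$$ $$\hat\varsigma_k=\hat\lambda^\star_k-\rho^2\widehat Q_k\,\omega_k\sum_{k'}\tilde\omega_{k'}\big(\hat\lambda^\star_k-\hat\lambda^\star_{k'}\big).$$ **Theorem.** Under these assumptions the following hold. (a) Let $s\in\{\mathrm T,\mathrm P\}$. If type T-$s$ BP occurs when perturbing a link $\ell$, there is a $k$ such that $\ell$ is a link of $\mathcal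 P^k$ and exactly one of the following is true: (a1) type T-$s$ ATBP occurs with respect to $\mathcal P^k$; (a2) classical BP occurs in $\mathcal P^k$ when perturbing $\ell$. Conversely, if $\ell$ is a link of $\mathcal P^k$, one of (a1) and (a2) is true and the other one strictly does not occur, then type T-$s$ BP occurs when perturbing $\ell$. (b) Type P-T BP occurs when perturbing $\ell_{\mathrm P}$ if and only if $\ell_{\mathrm P}$ binds, with power flow from subnetwork $i$ to subnetwork $i'$, and $\widehat Q_i\hat\psi_i-\widehat Q_{i'}\hat\psi_{i'}<0$. (So type P-T BP occurs if and only if there is such an $\ell_{\mathrm P}$.) (c) Type P-P BP occurs when perturbing $\ell_{\mathrm P}$ if $\ell_{\mathrm P}$ binds, with power flow from subnetwork $i$ to subnetwork $i'$, and $\hat\varsigma_i-\hat\varsigma_{i'}>0$. -/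

import Mathlib

noncomputable section

open Classical

/-! ### Partial derivatives with a sign -/

/-- The partial derivative of `F` in the coordinate `i` exists at `v` and is strictly negative. -/
def PartialNeg {ι : Type*} (F : (ι → ℝ) → ℝ) (v : ι → ℝ) (i : ι) : Prop :=
  ∃ d : ℝ, d < 0 ∧ HasDerivAt (fun t => F (Function.update v i t)) d (v i)

/-- The partial derivative of `F` in the coordinate `i` exists at `v` and is strictly positive. -/
def PartialPos {ι : Type*} (F : (ι → ℝ) → ℝ) (v : ι → ℝ) (i : ι) : Prop :=
  ∃ d : ℝ, 0 < d ∧ HasDerivAt (fun t => F (Function.update v i t)) d (v i)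

/-! ### Traffic: link flows, affine travel costs, Wardrop equilibria -/

/-- The link flow `(A^LR x)_ℓ`; the route `r` uses the links in `routes r`. -/
def linkFlow {ι Link : Type*} [Fintype ι] (routes : ι → Finset Link) (x : ι → ℝ) (l : Link) : ℝ :=
  ∑ r, if l ∈ routes r then x r else 0

/-- The travel cost `c^tr_r(x) = ∑_{ℓ ∈ r} (α_ℓ (A^LR x)_ℓ + β_ℓ)`. -/
def travelCost {ι Link : Type*} [Fintype ι] (routes : ι → Finset Link) (α β : Link → ℝ)
    (x : ι → ℝ) (r : ι) : ℝ :=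
  ∑ l ∈ routes r, (α l * linkFlow routes x l + β l)

/-- `x` is a nonnegative flow of total value `D`, and every used route has minimal cost. -/
def IsWardrop {ι : Type*} [Fintype ι] (D : ℝ) (c : ι → ℝ) (x : ι → ℝ) : Prop :=
  (∀ r, 0 ≤ x r) ∧ ∑ r, x r = D ∧ ∀ r, 0 < x r → ∀ r', c r ≤ c r'

/-- The flow at a classical user equilibrium of demand `D` (prices play no role). -/
def classicalFlow {ι Link : Type*} [Fintype ι] (routes : ι → Finset Link) (α β : Link → ℝ)
    (D : ℝ) : ι → ℝ :=
  Classical.epsilon fun x => IsWardrop D (travelCost routes α β x) x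

/-- The total travel cost at the classical user equilibrium of demand `D`. -/
def classicalCost {ι Link : Type*} [Fintype ι] (routes : ι → Finset Link) (α β : Link → ℝ)
    (D : ℝ) : ℝ :=
  ∑ r, classicalFlow routes α β D r * travelCost routes α β (classicalFlow routes α β D) r

/-! ### The coupled system -/

/-- A coupled transportation and power system with a radial power network. The road coefficients
`α` and the flow limits `fbar`, which are perturbed, are kept as separate arguments. Each index
`c : Limit` is one flow constraint: the power flow on the line from `tail c` to `head c`, in this
direction, is at most `fbar c`. -/
structure CoupledSystem (Route Link Charger Bus Limit : Type*) where
  /-- the links of a route -/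
  links : Route → Finset Link
  /-- the charging point of a route -/
  charger : Route → Charger
  /-- the bus of a charging point -/
  chargerBus : Charger → Bus
  /-- free-flow travel costs of the links -/
  β : Link → ℝ
  /-- charging need of a traveler -/
  ρ : ℝ
  /-- quadratic generation cost coefficients -/
  Q : Bus → ℝ
  /-- linear generation cost coefficients -/
  μ : Bus → ℝ
  /-- the power network -/
  grid : SimpleGraph Bus
  /-- the bus at which a limited line starts -/
  tail : Limit → Bus
  /-- the bus at which a limited line ends -/
  head : Limit → Bus
  β_nonneg : ∀ l, 0 ≤ β l
  ρ_pos : 0 < ρ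
  Q_pos : ∀ i, 0 < Q i
  isTree : grid.IsTree
  adj : ∀ c, grid.Adj (tail c) (head c)

/-- The two social costs: that of the transportation and that of the power system. -/
inductive Sector
  | T
  | P

/-- A constraint binding pattern: the flow limits that bind and the routes with `x_r = 0`. -/
structure BindingPattern (Route Limit : Type*) where
  limits : Set Limit
  routes : Set Route

namespace CoupledSystem

variable {Route Link Charger Bus Limit : Type*}

/-! ### Subnetworks -/

/-- The power network without its congested lines. -/
def uncongestedGrid (S : CoupledSystem Route Link Charger Bus Limit)
    (B : BindingPattern Route Limit) : SimpleGraph Bus :=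
  S.grid.deleteEdges {e | ∃ c ∈ B.limits, e = s(S.tail c, S.head c)}

/-- The subnetworks: groups of buses connected by uncongested lines. -/
def Subnetwork (S : CoupledSystem Route Link Charger Bus Limit)
    (B : BindingPattern Route Limit) : Type _ :=
  (S.uncongestedGrid B).ConnectedComponent

/-- The subnetwork of a bus. -/
def sub (S : CoupledSystem Route Link Charger Bus Limit) (B : BindingPattern Route Limit)
    (i : Bus) : S.Subnetwork B :=
  (S.uncongestedGrid B).connectedComponentMk i

theorem sub_surjective (S : CoupledSystem Route Link Charger Bus Limit)
    (B : BindingPattern Route Limit) : Function.Surjective (S.sub B) :=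
  Quot.mk_surjective

variable [Fintype Route] [Fintype Link] [Fintype Bus] [Fintype Limit]

/-- The bus at which the travelers on route `r` charge. -/
def bus (S : CoupledSystem Route Link Charger Bus Limit) (r : Route) : Bus :=
  S.chargerBus (S.charger r)

/-- The charging loads `d(x)`. -/
def load (S : CoupledSystem Route Link Charger Bus Limit) (x : Route → ℝ) (i : Bus) : ℝ :=
  S.ρ * ∑ r, if S.bus r = i then x r else 0

/-- The shift factor matrix `H`. In a tree and under `∑ p = 0`, the flow on a line is the net
injection on the side of its start, i.e. in the part that contains `tail c` when the line is cut. -/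
def shiftFactor (S : CoupledSystem Route Link Charger Bus Limit) (c : Limit) (i : Bus) : ℝ :=
  if (S.grid.deleteEdges {s(S.tail c, S.head c)}).Reachable (S.tail c) i then 1 else 0

/-- The power flow `(H p)_c`. -/
def flow (S : CoupledSystem Route Link Charger Bus Limit) (p : Bus → ℝ) (c : Limit) : ℝ :=
  ∑ i, S.shiftFactor c i * p i

/-- The generation cost `½ gᵀ Q g + μᵀ g`. -/
def genCost (S : CoupledSystem Route Link Charger Bus Limit) (g : Bus → ℝ) : ℝ :=
  ∑ i, (S.Q i * g i ^ 2 / 2 + S.μ i * g i)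

/-- Feasibility for the economic dispatch with traffic `x`. -/
def DispatchFeasible (S : CoupledSystem Route Link Charger Bus Limit) (fbar : Limit → ℝ)
    (x : Route → ℝ) (g p : Bus → ℝ) : Prop :=
  (∀ i, g i - S.load x i = p i) ∧ ∑ i, p i = 0 ∧ ∀ c, S.flow p c ≤ fbar c

/-- The optimal value of the economic dispatch with traffic `x`. -/
def dispatchValue (S : CoupledSystem Route Link Charger Bus Limit) (fbar : Limit → ℝ)
    (x : Route → ℝ) : ℝ :=
  sInf {v | ∃ g p, S.DispatchFeasible fbar x g p ∧ v = S.genCost g}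

/-- `lam` is a vector of locational marginal prices: with the Lagrangian
`genCost g - lamᵀ(g - d(x) - p) + γ 1ᵀp + ηᵀ(H p - fbar)`, it is the multiplier of the nodal
balance in an optimal primal-dual solution of the economic dispatch. -/
def IsLMP (S : CoupledSystem Route Link Charger Bus Limit) (fbar : Limit → ℝ)
    (x : Route → ℝ) (lam : Bus → ℝ) : Prop :=
  ∃ (g p : Bus → ℝ) (γ : ℝ) (η : Limit → ℝ),
    S.DispatchFeasible fbar x g p ∧
    (∀ g' p', S.DispatchFeasible fbar x g' p' → S.genCost g ≤ S.genCost g') ∧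
    (∀ c, 0 ≤ η c) ∧
    (∀ i, S.Q i * g i + S.μ i = lam i) ∧
    (∀ i, lam i + γ + ∑ c, η c * S.shiftFactor c i = 0) ∧
    (∀ c, η c * (S.flow p c - fbar c) = 0)

/-- The total cost of a traveler on route `r`: travel cost plus charging cost. -/
def routeCost (S : CoupledSystem Route Link Charger Bus Limit) (α : Link → ℝ)
    (x : Route → ℝ) (lam : Bus → ℝ) (r : Route) : ℝ :=
  travelCost S.links α S.β x r + S.ρ * lam (S.bus r)

/-- Generalized user equilibrium `(x, lam)` of the coupled system. -/
def IsGUE (S : CoupledSystem Route Link Charger Bus Limit) (α : Link → ℝ) (fbar : Limit → ℝ)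
    (x : Route → ℝ) (lam : Bus → ℝ) : Prop :=
  IsWardrop 1 (S.routeCost α x lam) x ∧ S.IsLMP fbar x lam

/-- The traffic at the generalized user equilibrium, as a function of the parameters. -/
def gueFlow (S : CoupledSystem Route Link Charger Bus Limit) (α : Link → ℝ) (fbar : Limit → ℝ) :
    Route → ℝ :=
  Classical.epsilon fun x => ∃ lam, S.IsGUE α fbar x lam

/-- The social costs `Φ_T` and `Φ_P` at equilibrium, as functions of the parameters. -/
def socialCost (S : CoupledSystem Route Link Charger Bus Limit) :
    Sector → (Link → ℝ) → (Limit → ℝ) → ℝ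
  | Sector.T, α, fbar =>
      ∑ r, S.gueFlow α fbar r * travelCost S.links α S.β (S.gueFlow α fbar) r
  | Sector.P, α, fbar => S.dispatchValue fbar (S.gueFlow α fbar)

/-- Type T-`s` Braess paradox when perturbing the road link `l`: `∂Φ_s/∂α_l < 0`. -/
def TBPAt (S : CoupledSystem Route Link Charger Bus Limit) (s : Sector) (α : Link → ℝ)
    (fbar : Limit → ℝ) (l : Link) : Prop :=
  PartialNeg (fun a => S.socialCost s a fbar) α l

/-- Type P-`s` Braess paradox when perturbing the flow limit `c`: `∂Φ_s/∂fbar_c > 0`. -/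
def PBPAt (S : CoupledSystem Route Link Charger Bus Limit) (s : Sector) (α : Link → ℝ)
    (fbar : Limit → ℝ) (c : Limit) : Prop :=
  PartialPos (fun f => S.socialCost s α f) fbar c

/-! ### Critical regions -/

/-- Feasibility for the convex program whose solutions are the equilibria. -/
def Feasible (S : CoupledSystem Route Link Charger Bus Limit) (fbar : Limit → ℝ)
    (z : (Route → ℝ) × (Bus → ℝ) × (Bus → ℝ)) : Prop :=
  S.DispatchFeasible fbar z.1 z.2.1 z.2.2 ∧ ∑ r, z.1 r = 1 ∧ ∀ r, 0 ≤ z.1 r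

/-- The objective of the convex program whose solutions are the equilibria. -/
def objective (S : CoupledSystem Route Link Charger Bus Limit) (α : Link → ℝ)
    (z : (Route → ℝ) × (Bus → ℝ) × (Bus → ℝ)) : ℝ :=
  S.genCost z.2.1 + ∑ l, (α l * linkFlow S.links z.1 l ^ 2 / 2 + S.β l * linkFlow S.links z.1 l)

/-- `z = (x, g, p)` is an optimal solution of the convex program. -/
def IsSolution (S : CoupledSystem Route Link Charger Bus Limit) (α : Link → ℝ)
    (fbar : Limit → ℝ) (z : (Route → ℝ) × (Bus → ℝ) × (Bus → ℝ)) : Prop :=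
  S.Feasible fbar z ∧ ∀ z', S.Feasible fbar z' → S.objective α z ≤ S.objective α z'

/-- The critical region of the pattern `B`: the parameters at which the solution of the convex
program, which is unique, has the binding constraints described by `B`. -/
def criticalRegion (S : CoupledSystem Route Link Charger Bus Limit)
    (B : BindingPattern Route Limit) : Set ((Link → ℝ) × (Limit → ℝ)) :=
  {θ | (∀ l, 0 ≤ θ.1 l) ∧ (∀ c, 0 < θ.2 c) ∧
    ∃ z, S.IsSolution θ.1 θ.2 z ∧ (∀ z', S.IsSolution θ.1 θ.2 z' → z' = z) ∧
      (∀ c, c ∈ B.limits ↔ S.flow z.2.2 c = θ.2 c) ∧ (∀ r, r ∈ B.routes ↔ z.1 r = 0)}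

/-! ### Route bundles -/

instance instFintypeSubnetwork (S : CoupledSystem Route Link Charger Bus Limit)
    (B : BindingPattern Route Limit) : Fintype (S.Subnetwork B) :=
  Fintype.ofSurjective (S.sub B) (S.sub_surjective B)

/-- The route bundle of the subnetwork `k`: active routes that charge in `k`. -/
def bundle (S : CoupledSystem Route Link Charger Bus Limit) (B : BindingPattern Route Limit)
    (k : S.Subnetwork B) : Set Route :=
  {r | r ∉ B.routes ∧ S.sub B (S.bus r) = k}

/-- The links used by the route bundle of `k`. -/
def bundleLinks (S : CoupledSystem Route Link Charger Bus Limit) (B : BindingPattern Route Limit)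
    (k : S.Subnetwork B) : Set Link :=
  {l | ∃ r ∈ S.bundle B k, l ∈ S.links r}

/-- The aggregate traffic of a bundle. -/
def aggFlow (S : CoupledSystem Route Link Charger Bus Limit) (B : BindingPattern Route Limit)
    (x : Route → ℝ) (k : S.Subnetwork B) : ℝ :=
  ∑ r : S.bundle B k, x r

/-- The price in the subnetwork `k`, read off at one of its buses. -/
def aggPrice (S : CoupledSystem Route Link Charger Bus Limit) (B : BindingPattern Route Limit)
    (lam : Bus → ℝ) (k : S.Subnetwork B) : ℝ :=
  lam (Function.surjInv (S.sub_surjective B) k)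

/-- Classical Braess paradox in the bundle of `k`, as a transportation network with net flow `D`,
when perturbing the link `l`. -/
def ClassicalBPAt (S : CoupledSystem Route Link Charger Bus Limit)
    (B : BindingPattern Route Limit) (α : Link → ℝ) (D : ℝ) (k : S.Subnetwork B) (l : Link) :
    Prop :=
  PartialNeg (fun a => classicalCost (fun r : S.bundle B k => S.links r) a S.β D) α l

/-- Strict non-occurrence of the classical Braess paradox in the bundle of `k` at the link `l`. -/
def ClassicalBPStrictlyNotAt (S : CoupledSystem Route Link Charger Bus Limit)
    (B : BindingPattern Route Limit) (α : Link → ℝ) (D : ℝ) (k : S.Subnetwork B) (l : Link) :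
    Prop :=
  PartialPos (fun a => classicalCost (fun r : S.bundle B k => S.links r) a S.β D) α l

/-! ### The aggregated system -/

/-- The matrix of the linear system, in the flows `x` of the active routes and the common travel
costs `c` of the bundles, that says that every route of a bundle `k` has travel cost `c k` and that
the bundles carry prescribed aggregate flows. Its right-hand side is `(-(A^LR)ᵀ β, aggregate flows)`,
so `c` is the affine function of the aggregate flows with the coefficients `aggAlpha`, `aggBeta`. -/
def bundleMatrix (S : CoupledSystem Route Link Charger Bus Limit)
    (B : BindingPattern Route Limit) (α : Link → ℝ) :
    Matrix ({r // r ∉ B.routes} ⊕ S.Subnetwork B) ({r // r ∉ B.routes} ⊕ S.Subnetwork B) ℝ :=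
  Matrix.fromBlocks
    (fun r r' => ∑ l ∈ S.links r ∩ S.links r', α l)
    (fun r k => if S.sub B (S.bus r) = k then -1 else 0)
    (fun k r => if S.sub B (S.bus r) = k then 1 else 0)
    0

/-- The coefficients `α̂_{k,k'}` in `ĉ_k = ∑_{k'} α̂_{k,k'} x̂_{k'} + β̂_k`. -/
def aggAlpha (S : CoupledSystem Route Link Charger Bus Limit) (B : BindingPattern Route Limit)
    (α : Link → ℝ) (k k' : S.Subnetwork B) : ℝ :=
  (S.bundleMatrix B α)⁻¹ (Sum.inr k) (Sum.inr k')

/-- The coefficients `β̂_k` in `ĉ_k = ∑_{k'} α̂_{k,k'} x̂_{k'} + β̂_k`. -/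
def aggBeta (S : CoupledSystem Route Link Charger Bus Limit) (B : BindingPattern Route Limit)
    (α : Link → ℝ) (k : S.Subnetwork B) : ℝ :=
  -∑ r : {r // r ∉ B.routes},
    (S.bundleMatrix B α)⁻¹ (Sum.inr k) (Sum.inl r) * ∑ l ∈ S.links r, S.β l

/-- `Q̂_k = (1ᵀ Q_k⁻¹ 1)⁻¹`. -/
def aggQ (S : CoupledSystem Route Link Charger Bus Limit) (B : BindingPattern Route Limit)
    (k : S.Subnetwork B) : ℝ :=
  (∑ i, if S.sub B i = k then (S.Q i)⁻¹ else 0)⁻¹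

/-- `μ̂_k = Q̂_k 1ᵀ Q_k⁻¹ μ_k`. -/
def aggMu (S : CoupledSystem Route Link Charger Bus Limit) (B : BindingPattern Route Limit)
    (k : S.Subnetwork B) : ℝ :=
  S.aggQ B k * ∑ i, if S.sub B i = k then (S.Q i)⁻¹ * S.μ i else 0

/-- The net power flow out of the subnetwork `k`; lines between subnetworks are at their limits. -/
def aggExport (S : CoupledSystem Route Link Charger Bus Limit) (B : BindingPattern Route Limit)
    (fbar : Limit → ℝ) (k : S.Subnetwork B) : ℝ :=
  ∑ c, if c ∈ B.limits then
    (if S.sub B (S.tail c) = k then fbar c else 0) - (if S.sub B (S.head c) = k then fbar c else 0)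
  else 0

/-- The generation of the subnetwork `k` when the bundles carry the flows `y`. -/
def aggGen (S : CoupledSystem Route Link Charger Bus Limit) (B : BindingPattern Route Limit)
    (fbar : Limit → ℝ) (y : S.Subnetwork B → ℝ) (k : S.Subnetwork B) : ℝ :=
  S.ρ * y k + S.aggExport B fbar k

/-- The travel cost of the bundle `k` in the aggregated system with coefficients `a` and `b`. -/
def aggTravelCost (S : CoupledSystem Route Link Charger Bus Limit)
    (B : BindingPattern Route Limit) (a : S.Subnetwork B × S.Subnetwork B → ℝ)
    (b : S.Subnetwork B → ℝ) (y : S.Subnetwork B → ℝ) (k : S.Subnetwork B) : ℝ :=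
  ∑ k', a (k, k') * y k' + b k

/-- The equilibrium traffic of the aggregated system with travel cost coefficients `a` and `b`:
bundles are its routes and subnetworks are its buses, the price of a bus is its marginal
generation cost, and its (fully congested) lines carry the flows `fbar`. -/
def aggGueFlow (S : CoupledSystem Route Link Charger Bus Limit) (B : BindingPattern Route Limit)
    (fbar : Limit → ℝ) (a : S.Subnetwork B × S.Subnetwork B → ℝ) (b : S.Subnetwork B → ℝ) :
    S.Subnetwork B → ℝ :=
  Classical.epsilon fun y => IsWardrop 1
    (fun k => S.aggTravelCost B a b y k +
      S.ρ * (S.aggQ B k * S.aggGen B fbar y k + S.aggMu B k)) y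

/-- The social costs of the aggregated system as functions of its travel cost coefficients
(`Φ_P` up to a constant that does not depend on them). -/
def aggSocialCost (S : CoupledSystem Route Link Charger Bus Limit)
    (B : BindingPattern Route Limit) (fbar : Limit → ℝ) :
    Sector → (S.Subnetwork B × S.Subnetwork B → ℝ) → (S.Subnetwork B → ℝ) → ℝ
  | Sector.T, a, b =>
      ∑ k, S.aggGueFlow B fbar a b k * S.aggTravelCost B a b (S.aggGueFlow B fbar a b) k
  | Sector.P, a, b =>
      ∑ k, (S.aggQ B k * S.aggGen B fbar (S.aggGueFlow B fbar a b) k ^ 2 / 2 +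
        S.aggMu B k * S.aggGen B fbar (S.aggGueFlow B fbar a b) k)

/-- Type T-`s` aggregated transportation Braess paradox with respect to the bundle of `k`. -/
def ATBP (S : CoupledSystem Route Link Charger Bus Limit) (B : BindingPattern Route Limit)
    (s : Sector) (α : Link → ℝ) (fbar : Limit → ℝ) (k : S.Subnetwork B) : Prop :=
  (∃ k', PartialNeg (fun a => S.aggSocialCost B fbar s a (S.aggBeta B α))
    (fun q => S.aggAlpha B α q.1 q.2) (k, k')) ∨
  PartialNeg (fun b => S.aggSocialCost B fbar s (fun q => S.aggAlpha B α q.1 q.2) b)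
    (S.aggBeta B α) k

/-- Strict non-occurrence of the type T-`s` aggregated transportation Braess paradox with respect
to the bundle of `k`: the derivatives in question are strictly positive. -/
def ATBPStrictlyNot (S : CoupledSystem Route Link Charger Bus Limit)
    (B : BindingPattern Route Limit) (s : Sector) (α : Link → ℝ) (fbar : Limit → ℝ)
    (k : S.Subnetwork B) : Prop :=
  (∀ k', PartialPos (fun a => S.aggSocialCost B fbar s a (S.aggBeta B α))
    (fun q => S.aggAlpha B α q.1 q.2) (k, k')) ∧
  PartialPos (fun b => S.aggSocialCost B fbar s (fun q => S.aggAlpha B α q.1 q.2) b)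
    (S.aggBeta B α) k

/-- `ω_k = 1 / (α̂_{k,k} + ρ² Q̂_k)`. -/
def omega (S : CoupledSystem Route Link Charger Bus Limit) (B : BindingPattern Route Limit)
    (α : Link → ℝ) (k : S.Subnetwork B) : ℝ :=
  1 / (S.aggAlpha B α k k + S.ρ ^ 2 * S.aggQ B k)

/-- `ω̃_k = ω_k / ∑_{k'} ω_{k'}`. -/
def omegaTilde (S : CoupledSystem Route Link Charger Bus Limit) (B : BindingPattern Route Limit)
    (α : Link → ℝ) (k : S.Subnetwork B) : ℝ :=
  S.omega B α k / ∑ k', S.omega B α k'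

/-- `ψ̂_k = ω_k (2 α̂_{k,k} x̂_k + β̂_k - ∑_{k'} ω̃_{k'} (2 α̂_{k',k'} x̂_{k'} + β̂_{k'}))`. -/
def psi (S : CoupledSystem Route Link Charger Bus Limit) (B : BindingPattern Route Limit)
    (α : Link → ℝ) (x : Route → ℝ) (k : S.Subnetwork B) : ℝ :=
  S.omega B α k *
    (2 * S.aggAlpha B α k k * S.aggFlow B x k + S.aggBeta B α k -
      ∑ k', S.omegaTilde B α k' *
        (2 * S.aggAlpha B α k' k' * S.aggFlow B x k' + S.aggBeta B α k'))

/-- `ς̂_i = λ̂_i - ρ² Q̂_i ω_i ∑_k ω̃_k (λ̂_i - λ̂_k)`. -/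
def varsigma (S : CoupledSystem Route Link Charger Bus Limit) (B : BindingPattern Route Limit)
    (α : Link → ℝ) (lam : Bus → ℝ) (i : S.Subnetwork B) : ℝ :=
  S.aggPrice B lam i - S.ρ ^ 2 * S.aggQ B i * S.omega B α i *
    ∑ k, S.omegaTilde B α k * (S.aggPrice B lam i - S.aggPrice B lam k)

end CoupledSystem

end

/-!
In the interior of a critical region the equilibrium is governed by an explicit linear system in the
bundle totals, and all signs in question are signs of derivatives of its solution.

*Equilibria and the convex program.* Moving a little from the solution of the convex program in
directions that respect the binding constraints shows that marginal generation costs are constant on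
subnetworks, do not decrease along congested lines, and are prices that make the traffic a Wardrop
flow. Shift factors of the binding limits generate all functions that are constant on subnetworks
(`exists_const_add_shiftFactor`), so the price differences along the congested lines are the
multipliers of the flow limits, and the solution is an equilibrium (`IsPatternSolution.isGUE`). By
convexity every equilibrium is a solution, hence the equilibrium traffic is unique (`gueFlow_eq`).
Being in the interior rules out two binding limits of one line (`simpleLimits_of_mem_interior`).

*Aggregation.* Uniqueness of the solution makes the bundle matrix invertible. It is block diagonal
as bundles share no links, so the matrix of the `α̂_{k,k'}` is diagonal, with nonnegative entries,
and `α̂_{k,k}` and `β̂_k` depend on the links of the bundle `k` only. The bundle totals `y` at the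
equilibrium satisfy `α̂_{k,k} y_k + β̂_k + ρ (Q̂_k (ρ y_k + f̂_k) + μ̂_k) = ν` for all `k` and
`∑ y_k = 1` (`IsPatternSolution.isBalanced`), and the social costs are those of the aggregated
system up to a constant (`socialCost_eq`).

*Derivatives.* If the costs of the bundles at fixed traffic change at the rates `w_k`, the totals
change at the rates `ω_k (∑_j ω̃_j w_j - w_k)` (`hasDerivAt_of_isBalanced`), which determines the
rates of the social costs (`hasDerivAt_systemCost`). Let `G_k` be the derivative of a social cost in
an exogenous increase of the cost of bundle `k`. A link `l` of the bundle `k` acts through the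
derivative `τ` of the bundle cost at fixed totals, so the social cost has the derivative `τ G_k`
(`hasDerivAt_socialCost_alpha`). The derivatives in the aggregated coefficients are positive
multiples of `G_k` (`atbp_iff`), and the classical total cost of the bundle has the derivative
`τ y_k` (`hasDerivAt_classicalCost`); hence the sign rule in (a). For a flow limit, only the exports change,
and the symmetry of the traffic response (`sum_mul_trafficResponse`) turns the derivatives into
differences of `Q̂ ψ̂` and of `ς̂`.
-/

section

open Classical Filter Topology

/-! ### Link flows and Wardrop flows -/

theorem linkFlow_add_mul {ι L : Type*} [Fintype ι] (routes : ι → Finset L) (x d : ι → ℝ) (s : ℝ)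
    (l : L) : linkFlow routes (fun r => x r + s * d r) l =
      linkFlow routes x l + s * linkFlow routes d l := by
  simp only [linkFlow, Finset.mul_sum, ← Finset.sum_add_distrib]
  exact Finset.sum_congr rfl fun r _ => by split_ifs <;> simp

/-- The pairing of a path flow with route costs is that of the link flow with link costs. -/
theorem sum_mul_sum_links {ι L : Type*} [Fintype ι] [Fintype L] (routes : ι → Finset L)
    (t : L → ℝ) (d : ι → ℝ) :
    ∑ r, (∑ l ∈ routes r, t l) * d r = ∑ l, t l * linkFlow routes d l := by
  simp only [linkFlow, Finset.mul_sum, Finset.sum_mul]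
  rw [Finset.sum_comm]
  refine Finset.sum_congr rfl fun r _ => ?_
  simp [Finset.sum_ite_mem, mul_ite]

theorem sum_comp_fiberwise {ι K : Type*} [Fintype ι] [Fintype K] (κ : ι → K) (σ : K → ℝ)
    (v : ι → ℝ) : ∑ r, σ (κ r) * v r = ∑ k, σ k * ∑ r, if κ r = k then v r else 0 := by
  simp only [Finset.mul_sum]
  rw [Finset.sum_comm]
  exact Finset.sum_congr rfl fun r _ => by simp

/-- A Wardrop flow minimizes the total cost at fixed route costs. -/
theorem IsWardrop.sum_mul_le {ι : Type*} [Fintype ι] {D : ℝ} {c x y : ι → ℝ}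
    (hx : IsWardrop D c x) (hy0 : ∀ r, 0 ≤ y r) (hy : ∑ r, y r = D) :
    ∑ r, c r * x r ≤ ∑ r, c r * y r := by
  obtain ⟨hx0, hxD, hmin⟩ := hx
  by_cases h : ∃ r, 0 < x r
  · obtain ⟨r₀, hr₀⟩ := h
    have h1 : ∑ r, c r * x r = ∑ r, c r₀ * x r := by
      refine Finset.sum_congr rfl fun r _ => ?_
      rcases (hx0 r).eq_or_lt with h0 | h0
      · simp [← h0]
      · rw [le_antisymm (hmin r h0 r₀) (hmin r₀ hr₀ r)]
    rw [h1, ← Finset.mul_sum, hxD, ← hy, Finset.mul_sum]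
    exact Finset.sum_le_sum fun r _ => mul_le_mul_of_nonneg_right (hmin r₀ hr₀ r) (hy0 r)
  · push Not at h
    have hx' : ∀ r, x r = 0 := fun r => le_antisymm (h r) (hx0 r)
    have hD : ∑ r, y r = 0 := by rw [hy, ← hxD]; simp [hx']
    have hy' := (Finset.sum_eq_zero_iff_of_nonneg fun r _ => hy0 r).1 hD
    simp [hx', fun r => hy' r (Finset.mem_univ r)]

theorem sum_eq_sum_subtype_of_forall {ι : Type*} [Fintype ι] {P : ι → Prop}
    [Fintype {r // P r}] {f : ι → ℝ} (h : ∀ r, ¬P r → f r = 0) :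
    ∑ r, f r = ∑ r : {r // P r}, f r := by
  rw [← Finset.sum_subset (Finset.subset_univ (Finset.univ.filter P))
    (fun r _ hr => h r (by simpa using hr))]
  exact Finset.sum_subtype _ (by simp) f

/-- If every route with nonzero flow has property `P`, other routes do not matter to link flows. -/
theorem linkFlow_subtype {ι L : Type*} [Fintype ι] {P : ι → Prop} [Fintype {r // P r}]
    (routes : ι → Finset L) {x : ι → ℝ} {l : L} (h : ∀ r, ¬P r → l ∈ routes r → x r = 0) :
    linkFlow (fun r : {r // P r} => routes r) (fun r => x r) l = linkFlow routes x l := by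
  unfold linkFlow
  rw [sum_eq_sum_subtype_of_forall (P := P)]
  intro r hr
  split_ifs with hl
  · exact h r hr hl
  · rfl

/-- Route costs at a Wardrop flow are unique, since link flows are. -/
theorem IsWardrop.travelCost_eq {ι L : Type*} [Fintype ι] [Fintype L] {routes : ι → Finset L}
    {α β : L → ℝ} (hα : ∀ l, 0 < α l) {D : ℝ} {x y : ι → ℝ}
    (hx : IsWardrop D (travelCost routes α β x) x) (hy : IsWardrop D (travelCost routes α β y) y) :
    travelCost routes α β x = travelCost routes α β y := by
  have h1 := hx.sum_mul_le hy.1 hy.2.1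
  have h2 := hy.sum_mul_le hx.1 hx.2.1
  have hlf : ∀ l, linkFlow routes (fun r => y r - x r) l =
      linkFlow routes y l - linkFlow routes x l := by
    intro l
    have := linkFlow_add_mul routes x (fun r => y r - x r) 1 l
    simp only [one_mul, add_sub_cancel] at this
    linarith
  have h3 : ∑ l, α l * (linkFlow routes y l - linkFlow routes x l) ^ 2 =
      (∑ r, travelCost routes α β x r * x r - ∑ r, travelCost routes α β x r * y r) +
      (∑ r, travelCost routes α β y r * y r - ∑ r, travelCost routes α β y r * x r) := by
    unfold travelCost
    simp only [sum_mul_sum_links, ← Finset.sum_sub_distrib, ← Finset.sum_add_distrib]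
    exact Finset.sum_congr rfl fun l _ => by ring
  have hterm : ∀ l, 0 ≤ α l * (linkFlow routes y l - linkFlow routes x l) ^ 2 := fun l =>
    mul_nonneg (hα l).le (sq_nonneg _)
  have h4 : ∑ l, α l * (linkFlow routes y l - linkFlow routes x l) ^ 2 = 0 :=
    le_antisymm (by linarith) (Finset.sum_nonneg fun l _ => hterm l)
  have h5 : ∀ l, linkFlow routes x l = linkFlow routes y l := fun l => by
    have := (Finset.sum_eq_zero_iff_of_nonneg fun l _ => hterm l).1 h4 l (Finset.mem_univ l)
    have := pow_eq_zero_iff two_ne_zero |>.1 ((mul_eq_zero.1 this).resolve_left (hα l).ne')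
    linarith
  ext r
  simp only [travelCost, h5]

/-- The total cost of a classical user equilibrium can be read off at any Wardrop flow. -/
theorem IsWardrop.classicalCost_eq {ι L : Type*} [Fintype ι] [Fintype L] {routes : ι → Finset L}
    {α β : L → ℝ} (hα : ∀ l, 0 < α l) {D : ℝ} {x : ι → ℝ}
    (hx : IsWardrop D (travelCost routes α β x) x) :
    classicalCost routes α β D = ∑ r, travelCost routes α β x r * x r := by
  have hex : ∃ x, IsWardrop D (travelCost routes α β x) x := ⟨x, hx⟩
  have hε : IsWardrop D (travelCost routes α β (classicalFlow routes α β D))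
      (classicalFlow routes α β D) := Classical.epsilon_spec hex
  have hc := hx.travelCost_eq hα hε
  have h1 := hx.sum_mul_le hε.1 hε.2.1
  have h2 := hε.sum_mul_le hx.1 hx.2.1
  rw [← hc] at h2
  rw [classicalCost, ← hc]
  simp only [mul_comm (classicalFlow routes α β D _)]
  exact le_antisymm h2 h1

namespace CoupledSystem

variable {Route Link Charger Bus Limit : Type*}

/-! ### Shift factors and subnetworks of a tree -/

section Graph

/-- A function that does not change along the edges of a graph is constant on its components. -/
theorem eq_of_reachable_of_adj {V X : Type*} {G : SimpleGraph V} {φ : V → X}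
    (h : ∀ i j, G.Adj i j → φ i = φ j) {i j : V} (hij : G.Reachable i j) : φ i = φ j := by
  obtain ⟨w⟩ := hij
  induction w with
  | nil => rfl
  | cons hadj _ ih => exact (h _ _ hadj).trans ih

variable [Fintype Bus] (S : CoupledSystem Route Link Charger Bus Limit)

theorem shiftFactor_tail (c : Limit) : S.shiftFactor c (S.tail c) = 1 := by
  simp [shiftFactor]

theorem shiftFactor_head (c : Limit) : S.shiftFactor c (S.head c) = 0 := by
  have h := SimpleGraph.isAcyclic_iff_forall_isBridge.1 S.isTree.isAcyclic
  have h2 := SimpleGraph.isBridge_iff.1 (h (e := s(S.tail c, S.head c)) (S.adj c))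
  simp [shiftFactor, h2]

theorem shiftFactor_eq_of_adj (c : Limit) {i j : Bus} (hij : S.grid.Adj i j)
    (hne : s(i, j) ≠ s(S.tail c, S.head c)) : S.shiftFactor c i = S.shiftFactor c j := by
  have hadj : (S.grid.deleteEdges {s(S.tail c, S.head c)}).Adj i j := by
    rw [SimpleGraph.deleteEdges_adj]
    exact ⟨hij, by simpa using hne⟩
  unfold shiftFactor
  congr 1
  exact propext ⟨fun h => h.trans hadj.reachable, fun h => h.trans hadj.symm.reachable⟩

variable {S} {B : BindingPattern Route Limit}

omit [Fintype Bus] in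
theorem sub_eq_of_adj {i j : Bus} (hij : (S.uncongestedGrid B).Adj i j) : S.sub B i = S.sub B j :=
  SimpleGraph.ConnectedComponent.eq.2 hij.reachable

theorem shiftFactor_eq_of_sub_eq {c : Limit} (hc : c ∈ B.limits) {i j : Bus}
    (hij : S.sub B i = S.sub B j) : S.shiftFactor c i = S.shiftFactor c j := by
  refine eq_of_reachable_of_adj (G := S.uncongestedGrid B) (fun a b hab => ?_)
    (SimpleGraph.ConnectedComponent.eq.1 hij)
  rw [uncongestedGrid, SimpleGraph.deleteEdges_adj] at hab
  exact S.shiftFactor_eq_of_adj c hab.1 fun h => hab.2 ⟨c, hc, h⟩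

variable (S B) in
/-- Every congested line carries one binding flow limit only. -/
def SimpleLimits : Prop :=
  ∀ c ∈ B.limits, ∀ c' ∈ B.limits, s(S.tail c, S.head c) = s(S.tail c', S.head c') → c = c'

/-- The shift factors of the binding limits span the functions that are constant on the
subnetworks, up to constants: both sides change by the same amount along every edge of the tree. -/
theorem exists_const_add_shiftFactor [Fintype Limit] (hS : S.SimpleLimits B) (φ : Bus → ℝ)
    (hφ : ∀ i j, S.sub B i = S.sub B j → φ i = φ j) :
    ∃ C, ∀ i, φ i = C + ∑ c, (if c ∈ B.limits then φ (S.tail c) - φ (S.head c) else 0) *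
      S.shiftFactor c i := by
  set D : Bus → ℝ := fun i => φ i -
    ∑ c, (if c ∈ B.limits then φ (S.tail c) - φ (S.head c) else 0) * S.shiftFactor c i with hD
  have key : ∀ i j, S.grid.Adj i j → D i = D j := by
    intro i j hij
    simp only [hD]
    by_cases hcong : ∃ c ∈ B.limits, s(i, j) = s(S.tail c, S.head c)
    · obtain ⟨c, hc, he⟩ := hcong
      have hrest : ∀ c' ∈ Finset.univ, c' ≠ c →
          (if c' ∈ B.limits then φ (S.tail c') - φ (S.head c') else 0) * (S.shiftFactor c' i -
            S.shiftFactor c' j) = 0 := by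
        intro c' _ hne
        by_cases hc' : c' ∈ B.limits
        · rw [S.shiftFactor_eq_of_adj c' hij fun h => hne (hS _ hc' _ hc (h.symm.trans he))]
          simp
        · simp [hc']
      have hsum := Finset.sum_eq_single_of_mem c (Finset.mem_univ c) hrest
      simp only [mul_sub, Finset.sum_sub_distrib, hc, if_true] at hsum
      rcases Sym2.eq_iff.1 he with ⟨rfl, rfl⟩ | ⟨rfl, rfl⟩
      · rw [shiftFactor_tail, shiftFactor_head] at hsum
        linarith
      · rw [shiftFactor_tail, shiftFactor_head] at hsum
        linarith
    · have hsub : S.sub B i = S.sub B j := by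
        apply sub_eq_of_adj
        rw [uncongestedGrid, SimpleGraph.deleteEdges_adj]
        exact ⟨hij, hcong⟩
      rw [hφ i j hsub]
      congr 1
      refine Finset.sum_congr rfl fun c _ => ?_
      by_cases hc : c ∈ B.limits
      · rw [shiftFactor_eq_of_sub_eq hc hsub]
      · simp [hc]
  obtain ⟨i₀⟩ := S.isTree.connected.nonempty
  refine ⟨D i₀, fun i => ?_⟩
  rw [← eq_of_reachable_of_adj key (S.isTree.connected.preconnected i i₀)]
  simp [hD]

/-- Cutting a line splits the tree in two parts. -/
theorem shiftFactor_add_of_reverse {c c' : Limit} (ht : S.tail c = S.head c')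
    (hh : S.head c = S.tail c') (i : Bus) : S.shiftFactor c i + S.shiftFactor c' i = 1 := by
  have h1 := S.shiftFactor_tail c
  have h2 := S.shiftFactor_head c
  have h3 := S.shiftFactor_tail c'
  have h4 := S.shiftFactor_head c'
  have key : ∀ i j, S.grid.Adj i j → S.shiftFactor c i + S.shiftFactor c' i =
      S.shiftFactor c j + S.shiftFactor c' j := by
    intro i j hij
    by_cases he : s(i, j) = s(S.tail c, S.head c)
    · rcases Sym2.eq_iff.1 he with ⟨rfl, rfl⟩ | ⟨rfl, rfl⟩
      · rw [h1, h2, ht, hh, h3, h4]; norm_num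
      · rw [h1, h2, ht, hh, h3, h4]; norm_num
    · rw [S.shiftFactor_eq_of_adj c hij he, S.shiftFactor_eq_of_adj c' hij]
      rwa [← ht, ← hh, Sym2.eq_swap (a := S.head c)]
  rw [eq_of_reachable_of_adj (φ := fun i => S.shiftFactor c i + S.shiftFactor c' i) key
    (S.isTree.connected.preconnected i (S.tail c)), h1, ht, h4, add_zero]

theorem shiftFactor_congr {c c' : Limit} (ht : S.tail c = S.tail c')
    (hh : S.head c = S.head c') : S.shiftFactor c = S.shiftFactor c' := by
  unfold shiftFactor
  rw [ht, hh]

end Graph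

/-! ### Linearity of loads and power flows -/

section Pairing

variable [Fintype Route] [Fintype Bus] (S : CoupledSystem Route Link Charger Bus Limit)

omit [Fintype Bus] in
theorem load_add_mul (x d : Route → ℝ) (s : ℝ) (i : Bus) :
    S.load (fun r => x r + s * d r) i = S.load x i + s * S.load d i := by
  have : (∑ r, if S.bus r = i then x r + s * d r else 0) =
      (∑ r, if S.bus r = i then x r else 0) + s * ∑ r, if S.bus r = i then d r else 0 := by
    rw [Finset.mul_sum, ← Finset.sum_add_distrib]
    exact Finset.sum_congr rfl fun r _ => by split_ifs <;> simp
  simp only [load, this]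
  ring

theorem sum_mul_load (L : Bus → ℝ) (d : Route → ℝ) :
    ∑ i, L i * S.load d i = S.ρ * ∑ r, L (S.bus r) * d r := by
  rw [sum_comp_fiberwise S.bus L d, Finset.mul_sum]
  exact Finset.sum_congr rfl fun i _ => by rw [load]; ring

omit [Fintype Route] in
theorem flow_add_mul (p d : Bus → ℝ) (s : ℝ) (c : Limit) :
    S.flow (fun i => p i + s * d i) c = S.flow p c + s * S.flow d c := by
  simp only [flow, Finset.mul_sum, ← Finset.sum_add_distrib]
  exact Finset.sum_congr rfl fun i _ => by ring

omit [Fintype Route] in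
theorem genCost_add_mul (g d : Bus → ℝ) (s : ℝ) :
    S.genCost (fun i => g i + s * d i) = S.genCost g +
      s * ∑ i, (S.Q i * g i + S.μ i) * d i + s ^ 2 * ∑ i, S.Q i * d i ^ 2 / 2 := by
  simp only [genCost, Finset.mul_sum, ← Finset.sum_add_distrib]
  exact Finset.sum_congr rfl fun i _ => by ring

variable [Fintype Link]

theorem objective_add_mul (α : Link → ℝ) (x dx : Route → ℝ) (g dg p p' : Bus → ℝ) (s : ℝ) :
    S.objective α (fun r => x r + s * dx r, fun i => g i + s * dg i, p') =
      S.objective α (x, g, p) +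
      s * (∑ i, (S.Q i * g i + S.μ i) * dg i + ∑ r, travelCost S.links α S.β x r * dx r) +
      s ^ 2 * (∑ i, S.Q i * dg i ^ 2 / 2 + ∑ l, α l * linkFlow S.links dx l ^ 2 / 2) := by
  have h : ∑ l, (α l * linkFlow S.links (fun r => x r + s * dx r) l ^ 2 / 2 +
        S.β l * linkFlow S.links (fun r => x r + s * dx r) l) =
      ∑ l, (α l * linkFlow S.links x l ^ 2 / 2 + S.β l * linkFlow S.links x l) +
      s * ∑ r, travelCost S.links α S.β x r * dx r +
      s ^ 2 * ∑ l, α l * linkFlow S.links dx l ^ 2 / 2 := by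
    unfold travelCost
    rw [sum_mul_sum_links]
    simp only [linkFlow_add_mul, Finset.mul_sum, ← Finset.sum_add_distrib]
    exact Finset.sum_congr rfl fun i _ => by ring
  simp only [objective, genCost_add_mul, h]
  ring

end Pairing

/-! ### Optimality conditions of the convex program -/

section Optimality

variable [Fintype Route] [Fintype Link] [Fintype Bus]
  {S : CoupledSystem Route Link Charger Bus Limit} {B : BindingPattern Route Limit}
  {α : Link → ℝ} {fbar : Limit → ℝ} {x : Route → ℝ} {g p : Bus → ℝ}

omit [Fintype Link] in
/-- Moving from a feasible point in a direction that respects the binding constraints keeps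
feasibility for a while. -/
theorem eventually_feasible [Fintype Limit] (hz : S.Feasible fbar (x, g, p))
    (hlim : ∀ c, c ∈ B.limits ↔ S.flow p c = fbar c) (hrt : ∀ r, r ∈ B.routes ↔ x r = 0)
    {dx : Route → ℝ} {dg dp : Bus → ℝ} (hdp : ∀ i, dg i - S.load dx i = dp i)
    (hdx0 : ∑ r, dx r = 0) (hdp0 : ∑ i, dp i = 0)
    (hflow : ∀ c ∈ B.limits, S.flow dp c ≤ 0) (hdx : ∀ r ∈ B.routes, 0 ≤ dx r) :
    ∀ᶠ s in 𝓝[>] (0 : ℝ), S.Feasible fbar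
      (fun r => x r + s * dx r, fun i => g i + s * dg i, fun i => p i + s * dp i) := by
  obtain ⟨⟨hbal, hp0, hle⟩, hx1, hx0⟩ := hz
  simp only at hbal hp0 hle hx1 hx0
  have hcont : ∀ a b : ℝ, Tendsto (fun s : ℝ => a + s * b) (𝓝[>] 0) (𝓝 a) := by
    intro a b
    have : Tendsto (fun s : ℝ => a + s * b) (𝓝 0) (𝓝 (a + 0 * b)) :=
      (by fun_prop : Continuous fun s : ℝ => a + s * b).tendsto 0
    simpa using this.mono_left nhdsWithin_le_nhds
  have e1 : ∀ᶠ s in 𝓝[>] (0 : ℝ), ∀ c, S.flow p c + s * S.flow dp c ≤ fbar c := by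
    refine eventually_all.2 fun c => ?_
    by_cases hc : c ∈ B.limits
    · filter_upwards [self_mem_nhdsWithin] with s hs
      nlinarith [hflow c hc, hle c, (Set.mem_Ioi.1 hs)]
    · have hlt : S.flow p c < fbar c := lt_of_le_of_ne (hle c) fun h => hc ((hlim c).2 h)
      exact ((hcont _ (S.flow dp c)).eventually (gt_mem_nhds hlt)).mono fun s hs => hs.le
  have e2 : ∀ᶠ s in 𝓝[>] (0 : ℝ), ∀ r, 0 ≤ x r + s * dx r := by
    refine eventually_all.2 fun r => ?_
    by_cases hr : r ∈ B.routes
    · filter_upwards [self_mem_nhdsWithin] with s hs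
      exact add_nonneg (hx0 r) (mul_nonneg (le_of_lt hs) (hdx r hr))
    · have hlt : 0 < x r := lt_of_le_of_ne (hx0 r) fun h => hr ((hrt r).2 h.symm)
      exact ((hcont _ (dx r)).eventually (lt_mem_nhds hlt)).mono fun s hs => hs.le
  filter_upwards [e1, e2] with s h1 h2
  refine ⟨⟨fun i => ?_, ?_, fun c => ?_⟩, ?_, h2⟩
  · simp only [load_add_mul, ← hbal, ← hdp]; ring
  · simp [Finset.sum_add_distrib, ← Finset.mul_sum, hp0, hdp0]
  · simp only [flow_add_mul]; exact h1 c
  · simp [Finset.sum_add_distrib, ← Finset.mul_sum, hx1, hdx0]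

variable (S B) in
/-- `(x, g, p)` solves the convex program, and `B` lists its binding constraints. -/
def IsPatternSolution (α : Link → ℝ) (fbar : Limit → ℝ) (x : Route → ℝ) (g p : Bus → ℝ) : Prop :=
  S.IsSolution α fbar (x, g, p) ∧ (∀ c, c ∈ B.limits ↔ S.flow p c = fbar c) ∧
    ∀ r, r ∈ B.routes ↔ x r = 0

theorem IsPatternSolution.firstOrder [Fintype Limit]
    (hz : S.IsPatternSolution B α fbar x g p)
    {dx : Route → ℝ} {dg dp : Bus → ℝ} (hdp : ∀ i, dg i - S.load dx i = dp i)
    (hdx0 : ∑ r, dx r = 0) (hdp0 : ∑ i, dp i = 0)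
    (hflow : ∀ c ∈ B.limits, S.flow dp c ≤ 0) (hdx : ∀ r ∈ B.routes, 0 ≤ dx r) :
    0 ≤ ∑ i, (S.Q i * g i + S.μ i) * dg i + ∑ r, travelCost S.links α S.β x r * dx r := by
  obtain ⟨⟨hfeas, hmin⟩, hlim, hrt⟩ := hz
  set G := ∑ i, (S.Q i * g i + S.μ i) * dg i + ∑ r, travelCost S.links α S.β x r * dx r with hG
  set q := ∑ i, S.Q i * dg i ^ 2 / 2 + ∑ l, α l * linkFlow S.links dx l ^ 2 / 2 with hq
  have hev : ∀ᶠ s in 𝓝[>] (0 : ℝ), 0 ≤ G + s * q := by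
    filter_upwards [eventually_feasible hfeas hlim hrt hdp hdx0 hdp0 hflow hdx,
      self_mem_nhdsWithin] with s hs hpos
    have h := hmin _ hs
    rw [S.objective_add_mul α x dx g dg p _ s] at h
    have h' : 0 ≤ s * (G + s * q) := by nlinarith
    exact nonneg_of_mul_nonneg_right h' hpos
  have hcont : Tendsto (fun s : ℝ => G + s * q) (𝓝[>] 0) (𝓝 G) := by
    have : Tendsto (fun s : ℝ => G + s * q) (𝓝 0) (𝓝 (G + 0 * q)) :=
      (by fun_prop : Continuous fun s : ℝ => G + s * q).tendsto 0
    simpa using this.mono_left nhdsWithin_le_nhds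
  exact ge_of_tendsto hcont hev

omit [Fintype Route] [Fintype Link] in
theorem flow_single_sub (c : Limit) (i j : Bus) :
    S.flow (fun b => (if b = i then 1 else 0) - (if b = j then 1 else 0)) c =
      S.shiftFactor c i - S.shiftFactor c j := by
  simp [flow, mul_sub]

/-- Generation can be moved from `j` to `i` if this relieves or does not affect the binding
limits, so `i` is not cheaper than `j`. -/
theorem IsPatternSolution.marginal_le [Fintype Limit] (hz : S.IsPatternSolution B α fbar x g p)
    {i j : Bus} (h : ∀ c ∈ B.limits, S.shiftFactor c i ≤ S.shiftFactor c j) :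
    S.Q j * g j + S.μ j ≤ S.Q i * g i + S.μ i := by
  have := hz.firstOrder (dx := fun _ => 0)
    (dg := fun b => (if b = i then 1 else 0) - (if b = j then 1 else 0))
    (dp := fun b => (if b = i then 1 else 0) - (if b = j then 1 else 0))
    (by simp [load]) (by simp) (by simp)
    (fun c hc => by rw [flow_single_sub]; linarith [h c hc]) (by simp)
  simpa [mul_sub] using this

theorem IsPatternSolution.marginal_eq [Fintype Limit] (hz : S.IsPatternSolution B α fbar x g p)
    {i j : Bus} (h : S.sub B i = S.sub B j) : S.Q i * g i + S.μ i = S.Q j * g j + S.μ j :=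
  le_antisymm (hz.marginal_le fun _ hc => (shiftFactor_eq_of_sub_eq hc h).ge)
    (hz.marginal_le fun _ hc => (shiftFactor_eq_of_sub_eq hc h).le)

theorem IsPatternSolution.marginal_tail_le_head [Fintype Limit]
    (hz : S.IsPatternSolution B α fbar x g p)
    (hS : S.SimpleLimits B) {c : Limit} (hc : c ∈ B.limits) :
    S.Q (S.tail c) * g (S.tail c) + S.μ (S.tail c) ≤
      S.Q (S.head c) * g (S.head c) + S.μ (S.head c) := by
  refine hz.marginal_le fun c' hc' => ?_
  by_cases h : c = c'
  · subst h; rw [shiftFactor_head, shiftFactor_tail]; norm_num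
  · exact (S.shiftFactor_eq_of_adj c' (S.adj c) fun he => h (hS _ hc _ hc' he)).ge

/-- A traveler can switch routes if generation follows the load, so the switch does not pay. -/
theorem IsPatternSolution.routeCost_le [Fintype Limit] (hz : S.IsPatternSolution B α fbar x g p)
    {r r' : Route} (hr : 0 < x r) :
    S.routeCost α x (fun i => S.Q i * g i + S.μ i) r ≤
      S.routeCost α x (fun i => S.Q i * g i + S.μ i) r' := by
  have := hz.firstOrder
    (dx := fun q => (if q = r' then 1 else 0) - (if q = r then 1 else 0))
    (dg := S.load fun q => (if q = r' then 1 else 0) - (if q = r then 1 else 0))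
    (dp := fun _ => 0) (by simp) (by simp) (by simp) (by simp [flow])
    (fun q hq => by
      have : q ≠ r := fun h => hr.ne' (h ▸ (hz.2.2 q).1 hq)
      simp only [this, if_false, sub_zero]
      split_ifs <;> norm_num)
  rw [S.sum_mul_load] at this
  simp only [mul_sub, mul_ite, mul_one, mul_zero, Finset.sum_sub_distrib, Finset.sum_ite_eq',
    Finset.mem_univ, if_true] at this
  simp only [routeCost]
  linarith

/-- At the solutions of the convex program, marginal generation costs are prices that make the
traffic an equilibrium; the multiplier of a binding flow limit is the price difference along it. -/
theorem IsPatternSolution.isGUE [Fintype Limit] (hz : S.IsPatternSolution B α fbar x g p)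
    (hS : S.SimpleLimits B) : S.IsGUE α fbar x fun i => S.Q i * g i + S.μ i := by
  have hfeas := hz.1.1
  refine ⟨⟨hfeas.2.2, hfeas.2.1, fun r hr r' => hz.routeCost_le hr⟩, ?_⟩
  -- in `λ_i = C + ∑ (λ_tail - λ_head) * shiftFactor`, the multipliers are `λ_head - λ_tail`
  obtain ⟨C, hC⟩ := exists_const_add_shiftFactor hS (fun i => S.Q i * g i + S.μ i)
    (fun i j h => hz.marginal_eq h)
  refine ⟨g, p, -C, fun c => if c ∈ B.limits then
    (S.Q (S.head c) * g (S.head c) + S.μ (S.head c)) -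
      (S.Q (S.tail c) * g (S.tail c) + S.μ (S.tail c)) else 0,
    hfeas.1, ?_, ?_, fun i => rfl, ?_, ?_⟩
  · intro g' p' h'
    have := hz.1.2 (x, g', p') ⟨h', hfeas.2⟩
    simpa [objective] using this
  · intro c
    dsimp only
    split_ifs with hc
    · exact sub_nonneg.2 (hz.marginal_tail_le_head hS hc)
    · exact le_rfl
  · intro i
    have h := hC i
    dsimp only at h ⊢
    rw [h, add_neg_cancel_comm, ← Finset.sum_add_distrib]
    refine Finset.sum_eq_zero fun c _ => ?_
    split_ifs <;> ring
  · intro c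
    dsimp only
    split_ifs with hc
    · rw [(hz.2.1 c).1 hc]; ring
    · ring

theorem IsPatternSolution.dispatchValue_eq (hz : S.IsPatternSolution B α fbar x g p) :
    S.dispatchValue fbar x = S.genCost g := by
  have hfeas := hz.1.1
  refine IsLeast.csInf_eq ⟨⟨g, p, hfeas.1, rfl⟩, ?_⟩
  rintro _ ⟨g', p', h', rfl⟩
  have := hz.1.2 (x, g', p') ⟨h', hfeas.2⟩
  simpa [objective] using this

end Optimality

/-! ### Equilibria solve the convex program -/

section Sufficiency

variable [Fintype Route] [Fintype Link] [Fintype Bus] [Fintype Limit]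
  {S : CoupledSystem Route Link Charger Bus Limit}
  {α : Link → ℝ} {fbar : Limit → ℝ} {x : Route → ℝ} {lam : Bus → ℝ}

theorem IsGUE.exists_isSolution (hα : ∀ l, 0 ≤ α l) (h : S.IsGUE α fbar x lam) :
    ∃ g p, S.IsSolution α fbar (x, g, p) ∧ ∀ i, S.Q i * g i + S.μ i = lam i := by
  obtain ⟨hW, g, p, γ, η, hfeas, -, hη, hlam, hstat, hcomp⟩ := h
  refine ⟨g, p, ⟨⟨hfeas, hW.2.1, hW.1⟩, ?_⟩, hlam⟩
  rintro ⟨x', g', p'⟩ ⟨hfeas', hx1', hx0'⟩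
  simp only at hfeas' hx1' hx0'
  have hobj := S.objective_add_mul α x (fun r => x' r - x r) g (fun i => g' i - g i) p p' 1
  simp only [one_mul, add_sub_cancel, one_pow] at hobj
  rw [hobj]
  have hq : 0 ≤ ∑ i, S.Q i * (g' i - g i) ^ 2 / 2 +
      ∑ l, α l * linkFlow S.links (fun r => x' r - x r) l ^ 2 / 2 :=
    add_nonneg
      (Finset.sum_nonneg fun i _ => by have := (S.Q_pos i).le; positivity)
      (Finset.sum_nonneg fun l _ => by have := hα l; positivity)
  have hdg : ∀ i, g' i - g i = (p' i - p i) + S.load (fun r => x' r - x r) i := by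
    intro i
    have h1 := hfeas.1 i
    have h2 := hfeas'.1 i
    have h3 := S.load_add_mul x (fun r => x' r - x r) 1 i
    simp only [one_mul, add_sub_cancel] at h3
    linarith
  have hpow : 0 ≤ ∑ i, lam i * (p' i - p i) := by
    have h1 : ∑ i, lam i * (p' i - p i) =
        ∑ c, η c * (S.flow p c - S.flow p' c) := by
      have : ∀ i, lam i * (p' i - p i) =
          -γ * (p' i - p i) + ∑ c, η c * (S.shiftFactor c i * (p i - p' i)) := by
        intro i
        have : lam i = -γ - ∑ c, η c * S.shiftFactor c i := by linarith [hstat i]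
        rw [this, sub_mul, Finset.sum_mul, sub_eq_add_neg, ← Finset.sum_neg_distrib]
        congr 1
        exact Finset.sum_congr rfl fun c _ => by ring
      rw [Finset.sum_congr rfl fun i _ => this i, Finset.sum_add_distrib, ← Finset.mul_sum,
        Finset.sum_sub_distrib, hfeas.2.1, hfeas'.2.1, Finset.sum_comm]
      simp only [sub_zero, mul_zero, zero_add, flow, ← Finset.sum_sub_distrib, Finset.mul_sum,
        mul_sub]
    rw [h1]
    refine Finset.sum_nonneg fun c _ => ?_
    have := mul_le_mul_of_nonneg_left (hfeas'.2.2 c) (hη c)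
    linarith [hcomp c]
  have htr : 0 ≤ ∑ r, S.routeCost α x lam r * (x' r - x r) := by
    have := hW.sum_mul_le hx0' hx1'
    simp only [mul_sub, Finset.sum_sub_distrib]
    linarith
  have hgrad : ∑ i, (S.Q i * g i + S.μ i) * (g' i - g i) +
      ∑ r, travelCost S.links α S.β x r * (x' r - x r) =
      ∑ i, lam i * (p' i - p i) + ∑ r, S.routeCost α x lam r * (x' r - x r) := by
    simp only [hlam, hdg, mul_add, Finset.sum_add_distrib, S.sum_mul_load, routeCost, add_mul,
      Finset.mul_sum]
    rw [add_assoc, add_comm (∑ r, S.ρ * _)]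
    congr 2
    exact Finset.sum_congr rfl fun r _ => by ring
  linarith

variable {B : BindingPattern Route Limit}

omit [Fintype Limit] in
/-- Distinct binding limits of one line are impossible in the interior of a critical region: in the
same direction, raising one of the two would make one of them slack, and in opposite directions they
would add up to `0`. -/
theorem simpleLimits_of_mem_interior (h : (α, fbar) ∈ interior (S.criticalRegion B)) :
    S.SimpleLimits B := by
  have h0 : (α, fbar) ∈ S.criticalRegion B := interior_subset h
  obtain ⟨-, hpos, ⟨x, g, p⟩, hz, -, hlim, -⟩ := h0
  intro c hc c' hc' he
  rcases Sym2.eq_iff.1 he with ⟨ht, hh⟩ | ⟨ht, hh⟩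
  · by_contra hne
    have hcont : Continuous fun t : ℝ => (α, Function.update fbar c t) := by fun_prop
    have hev : ∀ᶠ t in 𝓝 (fbar c), (α, Function.update fbar c t) ∈ S.criticalRegion B := by
      have := hcont.continuousAt.eventually_mem (x := fbar c)
        (s := S.criticalRegion B) (by
          rw [Function.update_eq_self]; exact mem_interior_iff_mem_nhds.1 h)
      exact this
    obtain ⟨t, ht1, ht2⟩ : ∃ t, (α, Function.update fbar c t) ∈ S.criticalRegion B ∧
        fbar c < t :=
      ((hev.filter_mono nhdsWithin_le_nhds).and
        (self_mem_nhdsWithin : ∀ᶠ t in 𝓝[>] (fbar c), t ∈ Set.Ioi (fbar c))).exists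
    obtain ⟨-, -, z', -, -, hlim', -⟩ := ht1
    have e1 := (hlim' c).1 hc
    have e2 := (hlim' c').1 hc'
    have e3 := (hlim c).1 hc
    have e4 := (hlim c').1 hc'
    have hsf : ∀ q, S.flow q c = S.flow q c' := fun q => by
      simp only [flow, shiftFactor_congr ht hh]
    simp only [Function.update_self, Function.update_of_ne (Ne.symm hne)] at e1 e2
    rw [hsf] at e1 e3
    linarith
  · exfalso
    have e3 := (hlim c).1 hc
    have e4 := (hlim c').1 hc'
    have hsum : S.flow p c + S.flow p c' = 0 := by
      simp only [flow, ← Finset.sum_add_distrib, ← add_mul, shiftFactor_add_of_reverse ht hh,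
        one_mul]
      exact hz.1.1.2.1
    simp only at e3 e4
    linarith [hpos c, hpos c']

/-- In the critical region, the equilibrium traffic is that of the unique solution of the convex
program. -/
theorem gueFlow_eq (hS : S.SimpleLimits B) (h : (α, fbar) ∈ S.criticalRegion B) :
    ∃ g p, S.IsPatternSolution B α fbar (S.gueFlow α fbar) g p ∧
      (∀ z', S.IsSolution α fbar z' → z' = (S.gueFlow α fbar, g, p)) := by
  obtain ⟨hα, -, ⟨x, g, p⟩, hz, huniq, hlim, hrt⟩ := h
  have hps : S.IsPatternSolution B α fbar x g p := ⟨hz, hlim, hrt⟩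
  have hex : ∃ x, ∃ lam, S.IsGUE α fbar x lam := ⟨x, _, hps.isGUE hS⟩
  obtain ⟨lam, hlam⟩ := Classical.epsilon_spec hex
  obtain ⟨g', p', hsol, -⟩ := IsGUE.exists_isSolution hα hlam
  have heq : S.gueFlow α fbar = x := congrArg Prod.fst (huniq _ hsol)
  rw [heq]
  exact ⟨g, p, hps, huniq⟩

end Sufficiency

end CoupledSystem

/-! ### Linear systems that depend on a parameter -/

section LinearSystems

variable {n : Type*} [Fintype n] [DecidableEq n]

theorem differentiableAt_det {N : ℝ → Matrix n n ℝ} {t₀ : ℝ}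
    (hN : ∀ i j, DifferentiableAt ℝ (fun t => N t i j) t₀) :
    DifferentiableAt ℝ (fun t => (N t).det) t₀ := by
  simp only [Matrix.det_apply]
  refine DifferentiableAt.fun_sum fun σ _ => DifferentiableAt.const_smul ?_ _
  exact DifferentiableAt.fun_finsetProd fun i _ => hN _ _

theorem differentiableAt_inv_apply {N : ℝ → Matrix n n ℝ} {t₀ : ℝ}
    (hN : ∀ i j, DifferentiableAt ℝ (fun t => N t i j) t₀) (h0 : (N t₀).det ≠ 0) (i j : n) :
    DifferentiableAt ℝ (fun t => (N t)⁻¹ i j) t₀ := by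
  simp only [Matrix.inv_def, Ring.inverse_eq_inv', Matrix.smul_apply, Matrix.adjugate_apply,
    smul_eq_mul]
  refine ((differentiableAt_det hN).inv h0).mul (differentiableAt_det fun a b => ?_)
  simp only [Matrix.updateRow_apply]
  split_ifs
  · exact differentiableAt_const _
  · exact hN a b

theorem Matrix.det_ne_zero_of_forall_mulVec {M : Matrix n n ℝ}
    (h : ∀ v, M.mulVec v = 0 → v = 0) : M.det ≠ 0 := by
  intro h0
  obtain ⟨v, hv, hMv⟩ := Matrix.exists_mulVec_eq_zero_iff.2 h0
  exact hv (h v hMv)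

/-- The inverse of a matrix that is block diagonal for the labels `f` is block diagonal. -/
theorem Matrix.inv_apply_eq_zero_of_blockDiagonal {K : Type*} {M : Matrix n n ℝ} (f : n → K)
    (hM : ∀ i j, f i ≠ f j → M i j = 0) (hdet : M.det ≠ 0) {i j : n} (hij : f i ≠ f j) :
    M⁻¹ i j = 0 := by
  have hu : IsUnit M.det := hdet.isUnit
  have h1 : M⁻¹ * M = 1 := Matrix.nonsing_inv_mul _ hu
  have h2 : (Matrix.of fun i j => if f i = f j then M⁻¹ i j else 0) * M = 1 := by
    rw [← h1]
    ext i j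
    simp only [Matrix.mul_apply, Matrix.of_apply]
    by_cases h : f i = f j
    · refine Finset.sum_congr rfl fun k _ => ?_
      by_cases hk : f i = f k
      · simp [hk]
      · rw [hM k j fun h' => hk (h.trans h'.symm)]; simp
    · have h3 : ∑ k, M⁻¹ i k * M k j = (1 : Matrix n n ℝ) i j := by
        rw [← h1, Matrix.mul_apply]
      rw [h3, Matrix.one_apply_ne fun h' => h (congrArg f h')]
      refine Finset.sum_eq_zero fun k _ => ?_
      split_ifs with hk
      · rw [hM k j fun h' => h (hk.trans h'), mul_zero]
      · rw [zero_mul]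
  rw [Matrix.inv_eq_left_inv h2]
  simp [hij]

/-- A row of the inverse of a block diagonal matrix depends on the rows of its block only. -/
theorem Matrix.inv_row_congr_of_blockDiagonal {K : Type*} {M M' : Matrix n n ℝ} (f : n → K)
    (hM : ∀ i j, f i ≠ f j → M i j = 0) (hdet : M.det ≠ 0) (hdet' : M'.det ≠ 0) {i : n}
    (h : ∀ k j, f k = f i → M k j = M' k j) (j : n) : M⁻¹ i j = M'⁻¹ i j := by
  have h1 : Matrix.vecMul (fun k => M⁻¹ i k) M' = Matrix.vecMul (fun k => M⁻¹ i k) M := by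
    ext j
    refine Finset.sum_congr rfl fun k _ => ?_
    by_cases hk : f k = f i
    · dsimp only; rw [h k j hk]
    · dsimp only
      rw [Matrix.inv_apply_eq_zero_of_blockDiagonal f hM hdet (Ne.symm hk), zero_mul, zero_mul]
  have h2 : Matrix.vecMul (fun k => M⁻¹ i k) M = fun j => (1 : Matrix n n ℝ) i j := by
    rw [← Matrix.nonsing_inv_mul M hdet.isUnit]
    rfl
  have h3 : (fun k => M⁻¹ i k) = Matrix.vecMul (Matrix.vecMul (fun k => M⁻¹ i k) M') M'⁻¹ := by
    rw [Matrix.vecMul_vecMul, Matrix.mul_nonsing_inv M' hdet'.isUnit, Matrix.vecMul_one]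
  rw [h1, h2] at h3
  have h4 := congrFun h3 j
  simp only [Matrix.vecMul, dotProduct, Matrix.one_apply, ite_mul, one_mul, zero_mul,
    Finset.sum_ite_eq, Finset.mem_univ, if_true] at h4
  exact h4

end LinearSystems

/-! ### Comparative statics of the aggregated system -/

section Aggregated

variable {K : Type*} [Fintype K]

/-- The costs of all bundles, i.e. travel costs plus `ρ` times marginal generation costs, are equal
to `ν`, and the total traffic is `1`. -/
def IsBalanced (ρ : ℝ) (q m : K → ℝ) (A : K → K → ℝ) (b e y : K → ℝ) (ν : ℝ) : Prop :=
  (∀ k, ∑ k', A k k' * y k' + b k + ρ * (q k * (ρ * y k + e k) + m k) = ν) ∧ ∑ k, y k = 1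

/-- The response of the traffic to an exogenous change `w` of the bundle costs, where `ω k` is the
reciprocal of the slope of the cost of the bundle `k`. -/
noncomputable def trafficResponse (ω w : K → ℝ) (k : K) : ℝ :=
  ω k * (∑ j, ω j / (∑ j, ω j) * w j - w k)

/-- The social costs of the aggregated system at the traffic `y`. -/
noncomputable def systemCost (ρ : ℝ) (q m : K → ℝ) :
    Sector → (K → K → ℝ) → (K → ℝ) → (K → ℝ) → (K → ℝ) → ℝ
  | Sector.T, A, b, _, y => ∑ k, y k * (∑ k', A k k' * y k' + b k)
  | Sector.P, _, _, e, y => ∑ k, (q k * (ρ * y k + e k) ^ 2 / 2 + m k * (ρ * y k + e k))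

/-- The rate of change of the social costs if travel costs at fixed traffic change at the rates `τ`,
exports at the rates `e'` and traffic at the rates `y'`; `a` is the diagonal of the coefficients. -/
noncomputable def systemCostRate (ρ : ℝ) (q m a b e y : K → ℝ) :
    Sector → (K → ℝ) → (K → ℝ) → (K → ℝ) → ℝ
  | Sector.T, τ, _, y' => ∑ k, (2 * a k * y k + b k) * y' k + ∑ k, y k * τ k
  | Sector.P, _, e', y' => ∑ k, (q k * (ρ * y k + e k) + m k) * (ρ * y' k + e' k)

theorem trafficResponse_smul (ω w : K → ℝ) (s : ℝ) (k : K) :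
    trafficResponse ω (fun j => s * w j) k = s * trafficResponse ω w k := by
  have : ∑ j, ω j / (∑ j, ω j) * (s * w j) = s * ∑ j, ω j / (∑ j, ω j) * w j := by
    rw [Finset.mul_sum]
    exact Finset.sum_congr rfl fun j _ => by ring
  simp only [trafficResponse, this]
  ring

theorem systemCostRate_smul (ρ : ℝ) (q m a b e y ω τ : K → ℝ) (σ : Sector) (s : ℝ) :
    systemCostRate ρ q m a b e y σ (fun j => s * τ j) (fun _ => 0)
        (trafficResponse ω fun j => s * τ j) =
      s * systemCostRate ρ q m a b e y σ τ (fun _ => 0) (trafficResponse ω τ) := by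
  cases σ
  · simp only [systemCostRate, mul_add, Finset.mul_sum, trafficResponse_smul]
    congr 1 <;> exact Finset.sum_congr rfl fun j _ => by ring
  · simp only [systemCostRate, Finset.mul_sum, trafficResponse_smul]
    exact Finset.sum_congr rfl fun j _ => by ring

variable {ρ : ℝ} {q m : K → ℝ}

/-- The matrix of the equations `IsBalanced` in the unknowns `y` and `ν`. -/
noncomputable def balanceMatrix (ρ : ℝ) (q : K → ℝ) (A : K → K → ℝ) :
    Matrix (K ⊕ Unit) (K ⊕ Unit) ℝ :=
  Matrix.fromBlocks (Matrix.of fun k k' => A k k' + if k = k' then ρ ^ 2 * q k else 0)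
    (Matrix.of fun _ _ => -1) (Matrix.of fun _ _ => 1) 0

/-- The right-hand side of the equations `IsBalanced`. -/
noncomputable def balanceRhs (ρ : ℝ) (q m b e : K → ℝ) : K ⊕ Unit → ℝ :=
  Sum.elim (fun k => -(b k + ρ * (q k * e k + m k))) fun _ => 1

theorem isBalanced_iff {A : K → K → ℝ} {b e y : K → ℝ} {ν : ℝ} :
    IsBalanced ρ q m A b e y ν ↔
      (balanceMatrix ρ q A).mulVec (Sum.elim y fun _ => ν) = balanceRhs ρ q m b e := by
  rw [balanceMatrix, Matrix.fromBlocks_mulVec, balanceRhs, Sum.elim_eq_iff, funext_iff, funext_iff,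
    IsBalanced]
  refine and_congr (forall_congr' fun k => ?_) ?_
  · have : ∑ k', (A k k' + if k = k' then ρ ^ 2 * q k else 0) * y k' =
        ∑ k', A k k' * y k' + ρ ^ 2 * q k * y k := by
      simp [add_mul, Finset.sum_add_distrib]
    simp only [Pi.add_apply, Matrix.mulVec, dotProduct, Matrix.of_apply, Sum.elim_comp_inl,
      Sum.elim_comp_inr, this,
      Finset.univ_unique, Finset.sum_const, Finset.card_singleton, one_smul]
    constructor <;> intro h <;> linarith
  · simp [Matrix.mulVec, dotProduct]

theorem det_balanceMatrix_ne_zero [Nonempty K] {A : K → K → ℝ}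
    (hdiag : ∀ k k', k ≠ k' → A k k' = 0) (hpos : ∀ k, 0 < A k k + ρ ^ 2 * q k) :
    (balanceMatrix ρ q A).det ≠ 0 := by
  refine Matrix.det_ne_zero_of_forall_mulVec fun v hv => ?_
  obtain ⟨y, ν, rfl⟩ : ∃ y ν, v = Sum.elim y fun _ => ν :=
    ⟨fun k => v (Sum.inl k), v (Sum.inr ()), by ext (k | k) <;> rfl⟩
  have h1 : ∀ k, y k = ν * (A k k + ρ ^ 2 * q k)⁻¹ := by
    intro k
    have := congrFun hv (Sum.inl k)
    simp only [balanceMatrix, Matrix.mulVec, dotProduct, Fintype.sum_sum_type,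
      Matrix.fromBlocks_apply₁₁, Matrix.fromBlocks_apply₁₂, Matrix.of_apply, Sum.elim_inl,
      Sum.elim_inr,
      Pi.zero_apply, Finset.univ_unique, Finset.sum_const, Finset.card_singleton, one_smul] at this
    rw [Finset.sum_eq_single k (fun k' _ hk' => by simp [hdiag k k' hk'.symm, hk'.symm])
      (by simp)] at this
    simp only [if_true] at this
    rw [eq_mul_inv_iff_mul_eq₀ (hpos k).ne']
    linarith
  have h2 : ∑ k, y k = 0 := by
    have := congrFun hv (Sum.inr ())
    simpa [balanceMatrix, Matrix.mulVec, dotProduct] using this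
  simp only [h1, ← Finset.mul_sum] at h2
  have hν : ν = 0 := by
    refine (mul_eq_zero.1 h2).resolve_right (ne_of_gt ?_)
    exact Finset.sum_pos (fun k _ => inv_pos.2 (hpos k)) Finset.univ_nonempty
  ext (k | k)
  · simp [h1, hν]
  · simp [hν]

variable {A : ℝ → K → K → ℝ} {b e : ℝ → K → ℝ} {A' : K → K → ℝ} {b' e' : K → ℝ} {t₀ : ℝ}

omit [Fintype K] in
theorem differentiableAt_balanceMatrix (hA : ∀ k k', HasDerivAt (fun t => A t k k') (A' k k') t₀)
    (i j : K ⊕ Unit) : DifferentiableAt ℝ (fun t => balanceMatrix ρ q (A t) i j) t₀ := by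
  rcases i with k | k <;> rcases j with k' | k' <;>
    simp only [balanceMatrix, Matrix.fromBlocks_apply₁₁, Matrix.fromBlocks_apply₁₂,
      Matrix.fromBlocks_apply₂₁, Matrix.fromBlocks_apply₂₂, Matrix.of_apply]
  · exact (hA k k').differentiableAt.add_const _
  all_goals exact differentiableAt_const _

theorem differentiableAt_inv_mulVec_balanceRhs [Nonempty K]
    (hA : ∀ k k', HasDerivAt (fun t => A t k k') (A' k k') t₀)
    (hb : ∀ k, HasDerivAt (fun t => b t k) (b' k) t₀)
    (he : ∀ k, HasDerivAt (fun t => e t k) (e' k) t₀)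
    (hdiag : ∀ k k', k ≠ k' → A t₀ k k' = 0) (hpos : ∀ k, 0 < A t₀ k k + ρ ^ 2 * q k)
    (i : K ⊕ Unit) :
    DifferentiableAt ℝ
      (fun t => (balanceMatrix ρ q (A t))⁻¹.mulVec (balanceRhs ρ q m (b t) (e t)) i) t₀ := by
  simp only [Matrix.mulVec, dotProduct]
  refine DifferentiableAt.fun_sum fun j _ => DifferentiableAt.mul ?_ ?_
  · exact differentiableAt_inv_apply (differentiableAt_balanceMatrix hA)
      (det_balanceMatrix_ne_zero hdiag hpos) i j
  · rcases j with k | k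
    · have h1 := (hb k).differentiableAt
      have h2 := (he k).differentiableAt
      simp only [balanceRhs, Sum.elim_inl]
      fun_prop
    · exact differentiableAt_const _

theorem eventually_det_balanceMatrix_ne_zero [Nonempty K]
    (hA : ∀ k k', HasDerivAt (fun t => A t k k') (A' k k') t₀)
    (hdiag : ∀ k k', k ≠ k' → A t₀ k k' = 0) (hpos : ∀ k, 0 < A t₀ k k + ρ ^ 2 * q k) :
    ∀ᶠ t in 𝓝 t₀, (balanceMatrix ρ q (A t)).det ≠ 0 :=
  (differentiableAt_det (differentiableAt_balanceMatrix hA)).continuousAt.eventually_ne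
    (det_balanceMatrix_ne_zero hdiag hpos)

/-- Traffic that balances the costs along a differentiable path of parameters is differentiable, and
its derivative is the traffic response to the change of the costs at fixed traffic. -/
theorem hasDerivAt_of_isBalanced [Nonempty K]
    (hA : ∀ k k', HasDerivAt (fun t => A t k k') (A' k k') t₀)
    (hb : ∀ k, HasDerivAt (fun t => b t k) (b' k) t₀)
    (he : ∀ k, HasDerivAt (fun t => e t k) (e' k) t₀)
    (hdiag : ∀ k k', k ≠ k' → A t₀ k k' = 0) (hpos : ∀ k, 0 < A t₀ k k + ρ ^ 2 * q k)
    {y : ℝ → K → ℝ} (hbal : ∀ᶠ t in 𝓝 t₀, ∃ ν, IsBalanced ρ q m (A t) (b t) (e t) (y t) ν)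
    (k : K) :
    HasDerivAt (fun t => y t k) (trafficResponse (fun j => 1 / (A t₀ j j + ρ ^ 2 * q j))
      (fun j => ∑ k', A' j k' * y t₀ k' + b' j + ρ * q j * e' j) k) t₀ := by
  set v : ℝ → K ⊕ Unit → ℝ :=
    fun t => (balanceMatrix ρ q (A t))⁻¹.mulVec (balanceRhs ρ q m (b t) (e t)) with hv
  have hvd : ∀ i, DifferentiableAt ℝ (fun t => v t i) t₀ :=
    differentiableAt_inv_mulVec_balanceRhs hA hb he hdiag hpos
  have hev : ∀ᶠ t in 𝓝 t₀, (∀ k, y t k = v t (Sum.inl k)) ∧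
      IsBalanced ρ q m (A t) (b t) (e t) (y t) (v t (Sum.inr ())) := by
    filter_upwards [hbal, eventually_det_balanceMatrix_ne_zero hA hdiag hpos] with t ht hdet
    obtain ⟨ν, hν⟩ := ht
    have h1 : v t = Sum.elim (y t) fun _ => ν := by
      simp only [hv]
      rw [← isBalanced_iff.1 hν, Matrix.mulVec_mulVec,
        Matrix.nonsing_inv_mul _ hdet.isUnit, Matrix.one_mulVec]
    rw [h1]
    exact ⟨fun k => rfl, hν⟩
  have hy : ∀ k, HasDerivAt (fun t => y t k) (deriv (fun t => v t (Sum.inl k)) t₀) t₀ := fun k =>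
    (hvd (Sum.inl k)).hasDerivAt.congr_of_eventuallyEq (hev.mono fun t ht => ht.1 k)
  set y' : K → ℝ := fun k => deriv (fun t => v t (Sum.inl k)) t₀ with hy'
  set ν' : ℝ := deriv (fun t => v t (Sum.inr ())) t₀ with hν'
  set w : K → ℝ := fun j => ∑ k', A' j k' * y t₀ k' + b' j + ρ * q j * e' j with hw
  -- differentiate the balance equations
  have hsum : ∑ k, y' k = 0 := by
    have h1 : HasDerivAt (fun t => ∑ k, y t k) (∑ k, y' k) t₀ :=
      HasDerivAt.fun_sum fun k _ => hy k
    have h2 : HasDerivAt (fun t => ∑ k, y t k) 0 t₀ :=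
      (hasDerivAt_const t₀ (1 : ℝ)).congr_of_eventuallyEq (hev.mono fun t ht => ht.2.2)
    exact h1.unique h2
  have hloc : ∀ k, y' k = 1 / (A t₀ k k + ρ ^ 2 * q k) * (ν' - w k) := by
    intro k
    have h1 : HasDerivAt
        (fun t => ∑ k', A t k k' * y t k' + b t k + ρ * (q k * (ρ * y t k + e t k) + m k))
        (∑ k', (A' k k' * y t₀ k' + A t₀ k k' * y' k') + b' k +
          ρ * (q k * (ρ * y' k + e' k))) t₀ :=
      ((HasDerivAt.fun_sum fun k' _ => (hA k k').mul (hy k')).add (hb k)).add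
        ((((((hy k).const_mul ρ).add (he k)).const_mul (q k)).add_const (m k)).const_mul ρ)
    have h2 : HasDerivAt
        (fun t => ∑ k', A t k k' * y t k' + b t k + ρ * (q k * (ρ * y t k + e t k) + m k)) ν' t₀ :=
      (hvd (Sum.inr ())).hasDerivAt.congr_of_eventuallyEq (hev.mono fun t ht => ht.2.1 k)
    have h3 := h1.unique h2
    rw [Finset.sum_add_distrib, Finset.sum_eq_single (f := fun k' => A t₀ k k' * y' k') k
      (fun k' _ hk' => by simp [hdiag k k' hk'.symm]) (by simp)] at h3
    have := (hpos k).ne'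
    rw [one_div, eq_inv_mul_iff_mul_eq₀ this]
    simp only [hw]
    linarith
  set ω : K → ℝ := fun j => 1 / (A t₀ j j + ρ ^ 2 * q j) with hω
  have hωpos : 0 < ∑ j, ω j :=
    Finset.sum_pos (fun j _ => one_div_pos.2 (hpos j)) Finset.univ_nonempty
  have hν : ν' = ∑ j, ω j / (∑ j, ω j) * w j := by
    have h1 : ν' * ∑ j, ω j = ∑ j, ω j * w j := by
      have h2 : ∑ k, ω k * (ν' - w k) = 0 := by
        rw [← hsum]; exact Finset.sum_congr rfl fun k _ => (hloc k).symm
      simp only [mul_sub, Finset.sum_sub_distrib, ← Finset.sum_mul] at h2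
      linarith
    rw [eq_comm, ← mul_right_inj' hωpos.ne', mul_comm _ ν', h1, Finset.mul_sum]
    refine Finset.sum_congr rfl fun j _ => ?_
    field_simp
  have := hy k
  rw [show deriv (fun t => v t (Sum.inl k)) t₀ = y' k from rfl, hloc k, hν] at this
  exact this

/-- The derivative of the social costs along a path of parameters and balanced traffic. -/
theorem hasDerivAt_systemCost [Nonempty K]
    (hA : ∀ k k', HasDerivAt (fun t => A t k k') (A' k k') t₀)
    (hb : ∀ k, HasDerivAt (fun t => b t k) (b' k) t₀)
    (he : ∀ k, HasDerivAt (fun t => e t k) (e' k) t₀)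
    (hdiag : ∀ k k', k ≠ k' → A t₀ k k' = 0) (hpos : ∀ k, 0 < A t₀ k k + ρ ^ 2 * q k)
    {y : ℝ → K → ℝ} (hbal : ∀ᶠ t in 𝓝 t₀, ∃ ν, IsBalanced ρ q m (A t) (b t) (e t) (y t) ν)
    (σ : Sector) :
    HasDerivAt (fun t => systemCost ρ q m σ (A t) (b t) (e t) (y t))
      (systemCostRate ρ q m (fun k => A t₀ k k) (b t₀) (e t₀) (y t₀) σ
        (fun j => ∑ k', A' j k' * y t₀ k' + b' j) e'
        (trafficResponse (fun j => 1 / (A t₀ j j + ρ ^ 2 * q j))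
          fun j => ∑ k', A' j k' * y t₀ k' + b' j + ρ * q j * e' j)) t₀ := by
  have hy := hasDerivAt_of_isBalanced hA hb he hdiag hpos hbal
  set y' := trafficResponse (fun j => 1 / (A t₀ j j + ρ ^ 2 * q j))
    fun j => ∑ k', A' j k' * y t₀ k' + b' j + ρ * q j * e' j
  have hAy : ∀ (k : K) (z : K → ℝ), ∑ k', A t₀ k k' * z k' = A t₀ k k * z k := fun k z =>
    Finset.sum_eq_single k (fun k' _ hk' => by simp [hdiag k k' hk'.symm]) (by simp)
  cases σ
  · have h := HasDerivAt.fun_sum (u := Finset.univ) fun k _ => (hy k).mul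
      ((HasDerivAt.fun_sum (u := Finset.univ) fun k' _ => (hA k k').mul (hy k')).add (hb k))
    refine h.congr_deriv ?_
    simp only [systemCostRate, ← Finset.sum_add_distrib]
    refine Finset.sum_congr rfl fun k _ => ?_
    rw [Finset.sum_add_distrib]
    simp only [Pi.add_apply, Pi.mul_apply, hAy]
    ring
  · have h := HasDerivAt.fun_sum (u := Finset.univ) fun k _ =>
      ((((((hy k).const_mul ρ).add (he k)).fun_pow 2).const_mul (q k)).div_const 2).add
        ((((hy k).const_mul ρ).add (he k)).const_mul (m k))
    refine h.congr_deriv ?_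
    simp only [systemCostRate]
    refine Finset.sum_congr rfl fun k _ => ?_
    simp only [Pi.add_apply]
    push_cast
    ring

/-- Balanced positive traffic persists under small perturbations of the parameters. -/
theorem exists_isBalanced_pos [Nonempty K]
    (hA : ∀ k k', HasDerivAt (fun t => A t k k') (A' k k') t₀)
    (hb : ∀ k, HasDerivAt (fun t => b t k) (b' k) t₀)
    (he : ∀ k, HasDerivAt (fun t => e t k) (e' k) t₀)
    (hdiag : ∀ k k', k ≠ k' → A t₀ k k' = 0) (hpos : ∀ k, 0 < A t₀ k k + ρ ^ 2 * q k)
    {y₀ : K → ℝ} {ν₀ : ℝ} (h0 : IsBalanced ρ q m (A t₀) (b t₀) (e t₀) y₀ ν₀)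
    (hy₀ : ∀ k, 0 < y₀ k) :
    ∀ᶠ t in 𝓝 t₀, ∃ y ν, IsBalanced ρ q m (A t) (b t) (e t) y ν ∧ ∀ k, 0 < y k := by
  set v : ℝ → K ⊕ Unit → ℝ :=
    fun t => (balanceMatrix ρ q (A t))⁻¹.mulVec (balanceRhs ρ q m (b t) (e t)) with hv
  have hvd : ∀ i, DifferentiableAt ℝ (fun t => v t i) t₀ :=
    differentiableAt_inv_mulVec_balanceRhs hA hb he hdiag hpos
  have hdet := eventually_det_balanceMatrix_ne_zero hA hdiag hpos
  have h1 : v t₀ = Sum.elim y₀ fun _ => ν₀ := by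
    simp only [hv]
    rw [← isBalanced_iff.1 h0, Matrix.mulVec_mulVec,
      Matrix.nonsing_inv_mul _ hdet.self_of_nhds.isUnit, Matrix.one_mulVec]
  have hev : ∀ᶠ t in 𝓝 t₀, ∀ k, 0 < v t (Sum.inl k) := by
    refine eventually_all.2 fun k => (hvd (Sum.inl k)).continuousAt.eventually (lt_mem_nhds ?_)
    dsimp only; rw [h1]; exact hy₀ k
  filter_upwards [hdet, hev] with t ht1 ht2
  refine ⟨fun k => v t (Sum.inl k), v t (Sum.inr ()), isBalanced_iff.2 ?_, ht2⟩
  have : (Sum.elim (fun k => v t (Sum.inl k)) fun _ => v t (Sum.inr ())) = v t := by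
    ext (k | k) <;> rfl
  rw [this]
  simp only [hv]
  rw [Matrix.mulVec_mulVec, Matrix.mul_nonsing_inv _ ht1.isUnit, Matrix.one_mulVec]

/-- A Wardrop flow for strictly monotone route costs is unique. -/
theorem IsWardrop.eq_of_strictMonotone {D : ℝ} {C : (K → ℝ) → K → ℝ} {x y : K → ℝ}
    (hC : ∀ x y, x ≠ y → 0 < ∑ k, (C x k - C y k) * (x k - y k))
    (hx : IsWardrop D (C x) x) (hy : IsWardrop D (C y) y) : x = y := by
  by_contra hne
  have h1 := hx.sum_mul_le hy.1 hy.2.1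
  have h2 := hy.sum_mul_le hx.1 hx.2.1
  have h3 := hC x y hne
  have h4 : ∑ k, (C x k - C y k) * (x k - y k) =
      (∑ k, C x k * x k - ∑ k, C x k * y k) + (∑ k, C y k * y k - ∑ k, C y k * x k) := by
    simp only [← Finset.sum_sub_distrib, ← Finset.sum_add_distrib]
    exact Finset.sum_congr rfl fun k _ => by ring
  linarith

/-- The response to cost changes is symmetric. -/
theorem sum_mul_trafficResponse (ω w z : K → ℝ) :
    ∑ k, z k * trafficResponse ω w k = ∑ k, w k * trafficResponse ω z k := by
  have h : ∀ u v : K → ℝ, ∑ k, u k * trafficResponse ω v k =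
      (∑ k, ω k * u k) * (∑ k, ω k * v k) / (∑ k, ω k) - ∑ k, ω k * (u k * v k) := by
    intro u v
    have h1 : ∑ j, ω j / (∑ j, ω j) * v j = (∑ k, ω k * v k) / ∑ k, ω k := by
      rw [Finset.sum_div]
      exact Finset.sum_congr rfl fun j _ => by ring
    simp only [trafficResponse, h1]
    rw [mul_div_assoc, Finset.sum_mul, ← Finset.sum_sub_distrib]
    exact Finset.sum_congr rfl fun k _ => by ring
  rw [h, h, mul_comm (∑ k, ω k * z k)]
  congr 1
  exact Finset.sum_congr rfl fun k _ => by ring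

/-- The costs of the aggregated system are strictly monotone if the coefficients are diagonal with
positive slopes, up to a small change `s` of the coefficient at `(p, p')`. -/
theorem exists_strictMonotone [Nonempty K] {A : K → K → ℝ}
    (hdiag : ∀ k k', k ≠ k' → A k k' = 0) (hpos : ∀ k, 0 < A k k + ρ ^ 2 * q k) :
    ∃ δ > 0, ∀ (p p' : K) (s : ℝ), |s| < δ → ∀ (b e x y : K → ℝ), x ≠ y →
      0 < ∑ k, ((∑ k', (A k k' + if k = p ∧ k' = p' then s else 0) * x k' + b k +
          ρ * (q k * (ρ * x k + e k) + m k)) -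
        (∑ k', (A k k' + if k = p ∧ k' = p' then s else 0) * y k' + b k +
          ρ * (q k * (ρ * y k + e k) + m k))) * (x k - y k) := by
  obtain ⟨k₀, hk₀⟩ := Finite.exists_min fun k => A k k + ρ ^ 2 * q k
  refine ⟨A k₀ k₀ + ρ ^ 2 * q k₀, hpos k₀, fun p p' s hs b e x y hxy => ?_⟩
  set δ := A k₀ k₀ + ρ ^ 2 * q k₀ with hδ
  set d : K → ℝ := fun k => x k - y k with hd
  have hsq : 0 < ∑ k, d k ^ 2 := by
    obtain ⟨k, hk⟩ : ∃ k, d k ≠ 0 := by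
      by_contra h
      push Not at h
      exact hxy (funext fun k => sub_eq_zero.1 (h k))
    exact Finset.sum_pos' (fun k _ => sq_nonneg _) ⟨k, Finset.mem_univ k, by positivity⟩
  have hlin : ∀ z : K → ℝ, ∀ k, ∑ k', (A k k' + if k = p ∧ k' = p' then s else 0) * z k' =
      A k k * z k + if k = p then s * z p' else 0 := by
    intro z k
    simp only [add_mul, Finset.sum_add_distrib]
    congr 1
    · exact Finset.sum_eq_single k (fun k' _ hk' => by simp [hdiag k k' hk'.symm]) (by simp)
    · by_cases h : k = p <;> simp [h]
  have hexp : ∑ k, ((∑ k', (A k k' + if k = p ∧ k' = p' then s else 0) * x k' + b k +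
          ρ * (q k * (ρ * x k + e k) + m k)) -
        (∑ k', (A k k' + if k = p ∧ k' = p' then s else 0) * y k' + b k +
          ρ * (q k * (ρ * y k + e k) + m k))) * (x k - y k) =
      ∑ k, (A k k + ρ ^ 2 * q k) * d k ^ 2 + s * (d p * d p') := by
    have h1 : s * (d p * d p') = ∑ k, if k = p then s * (d p * d p') else 0 := by simp
    rw [h1, ← Finset.sum_add_distrib]
    refine Finset.sum_congr rfl fun k _ => ?_
    rw [hlin, hlin]
    by_cases h : k = p
    · subst h; simp only [if_true, hd]; ring
    · simp only [h, if_false, hd]; ring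
  rw [hexp]
  have h1 : δ * ∑ k, d k ^ 2 ≤ ∑ k, (A k k + ρ ^ 2 * q k) * d k ^ 2 := by
    rw [Finset.mul_sum]
    exact Finset.sum_le_sum fun k _ => mul_le_mul_of_nonneg_right (hk₀ k) (sq_nonneg _)
  have hle : ∀ k, d k ^ 2 ≤ ∑ k, d k ^ 2 := fun k =>
    Finset.single_le_sum (f := fun k => d k ^ 2) (fun k _ => sq_nonneg _) (Finset.mem_univ k)
  have h2 : |d p * d p'| ≤ ∑ k, d k ^ 2 := by
    have := hle p
    have := hle p'
    rw [abs_le]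
    constructor <;> nlinarith [sq_nonneg (d p + d p'), sq_nonneg (d p - d p')]
  have h3 : |s * (d p * d p')| < δ * ∑ k, d k ^ 2 := by
    rw [abs_mul]
    calc |s| * |d p * d p'| ≤ |s| * ∑ k, d k ^ 2 := mul_le_mul_of_nonneg_left h2 (abs_nonneg s)
      _ < δ * ∑ k, d k ^ 2 := mul_lt_mul_of_pos_right hs hsq
  linarith [neg_abs_le (s * (d p * d p'))]

end Aggregated

namespace CoupledSystem

variable {Route Link Charger Bus Limit : Type*} [Fintype Route] [Fintype Bus]
  {S : CoupledSystem Route Link Charger Bus Limit} {B : BindingPattern Route Limit}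

/-! ### The cost coefficients of the route bundles -/

section BundleMatrix

variable (S B) in
/-- The subnetwork in which an active route charges. -/
def activeSub (r : {r // r ∉ B.routes}) : S.Subnetwork B := S.sub B (S.bus r)

variable (S B) in
/-- Flows on the active routes are determined by the link flows and the bundle totals. -/
def BundleRegular : Prop :=
  ∀ v : {r // r ∉ B.routes} → ℝ,
    (∀ l, linkFlow (fun r : {r // r ∉ B.routes} => S.links r) v l = 0) →
    (∀ k, ∑ r, (if S.activeSub B r = k then v r else 0) = 0) → v = 0

theorem bundleMatrix_mulVec_inl (α : Link → ℝ) (v : {r // r ∉ B.routes} → ℝ)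
    (c : S.Subnetwork B → ℝ) (r : {r // r ∉ B.routes}) :
    (S.bundleMatrix B α).mulVec (Sum.elim v c) (Sum.inl r) =
      ∑ l ∈ S.links r, α l * linkFlow (fun r : {r // r ∉ B.routes} => S.links r) v l -
        c (S.activeSub B r) := by
  have h1 : (S.bundleMatrix B α).mulVec (Sum.elim v c) (Sum.inl r) =
      ∑ r' : {r // r ∉ B.routes}, (∑ l ∈ S.links r ∩ S.links r', α l) * v r' +
      ∑ k, (if S.activeSub B r = k then -1 else 0) * c k := by
    rw [Matrix.mulVec, dotProduct, Fintype.sum_sum_type]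
    rfl
  have h2 : ∑ k, (if S.activeSub B r = k then -1 else 0) * c k = -c (S.activeSub B r) := by simp
  rw [h1, h2, sub_eq_add_neg]
  congr 1
  simp only [linkFlow, Finset.mul_sum, Finset.sum_mul]
  rw [Finset.sum_comm]
  refine Finset.sum_congr rfl fun r' _ => ?_
  rw [← Finset.filter_mem_eq_inter, Finset.sum_filter]
  exact Finset.sum_congr rfl fun l _ => by split_ifs <;> simp

theorem bundleMatrix_mulVec_inr (α : Link → ℝ) (v : {r // r ∉ B.routes} → ℝ)
    (c : S.Subnetwork B → ℝ) (k : S.Subnetwork B) :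
    (S.bundleMatrix B α).mulVec (Sum.elim v c) (Sum.inr k) =
      ∑ r, if S.activeSub B r = k then v r else 0 := by
  have h1 : (S.bundleMatrix B α).mulVec (Sum.elim v c) (Sum.inr k) =
      ∑ r : {r // r ∉ B.routes}, (if S.activeSub B r = k then 1 else 0) * v r +
      ∑ k', (0 : ℝ) * c k' := by
    rw [Matrix.mulVec, dotProduct, Fintype.sum_sum_type]
    rfl
  simp [h1]

/-- The work of the bundle costs against flows: for a solution `(v, c)` of the bundle equations with
the right-hand side `(0, y)`, the quadratic form of the link flows of `v` equals `∑ c k * y k`. -/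
theorem sum_sq_linkFlow_eq [Fintype Link] {α : Link → ℝ} {v : {r // r ∉ B.routes} → ℝ}
    {c y : S.Subnetwork B → ℝ}
    (h : (S.bundleMatrix B α).mulVec (Sum.elim v c) = Sum.elim (fun _ => 0) y) :
    ∑ l, α l * linkFlow (fun r : {r // r ∉ B.routes} => S.links r) v l ^ 2 = ∑ k, c k * y k := by
  have h1 : ∀ r : {r // r ∉ B.routes},
      ∑ l ∈ S.links r, α l * linkFlow (fun r : {r // r ∉ B.routes} => S.links r) v l =
        c (S.activeSub B r) := by
    intro r
    have := congrFun h (Sum.inl r)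
    rw [bundleMatrix_mulVec_inl] at this
    simpa [sub_eq_zero] using this
  have h2 : ∀ k, ∑ r, (if S.activeSub B r = k then v r else 0) = y k := by
    intro k
    have := congrFun h (Sum.inr k)
    rw [bundleMatrix_mulVec_inr] at this
    simpa using this
  have h3 := sum_mul_sum_links (fun r : {r // r ∉ B.routes} => S.links r)
    (fun l => α l * linkFlow (fun r : {r // r ∉ B.routes} => S.links r) v l) v
  simp only [h1] at h3
  rw [sum_comp_fiberwise] at h3
  simp only [h2] at h3
  rw [h3]
  exact Finset.sum_congr rfl fun l _ => by ring

omit [Fintype Route] [Fintype Bus] in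
theorem exists_active (hne : ∀ k, (S.bundle B k).Nonempty) (k : S.Subnetwork B) :
    ∃ r, S.activeSub B r = k := by
  obtain ⟨r, hr, hk⟩ := hne k
  exact ⟨⟨r, hr⟩, hk⟩

theorem det_bundleMatrix_ne_zero [Fintype Link] (hreg : S.BundleRegular B)
    (hne : ∀ k, (S.bundle B k).Nonempty) {α : Link → ℝ} (hα : ∀ l, 0 < α l) :
    (S.bundleMatrix B α).det ≠ 0 := by
  refine Matrix.det_ne_zero_of_forall_mulVec fun w hw => ?_
  obtain ⟨v, c, rfl⟩ : ∃ v c, w = Sum.elim v c :=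
    ⟨fun k => w (Sum.inl k), fun k => w (Sum.inr k), by ext (k | k) <;> rfl⟩
  have h0 : (S.bundleMatrix B α).mulVec (Sum.elim v c) = Sum.elim (fun _ => 0) fun _ => 0 := by
    rw [hw]; ext (k | k) <;> rfl
  have hsq := sum_sq_linkFlow_eq h0
  simp only [mul_zero, Finset.sum_const_zero] at hsq
  have hlf : ∀ l, linkFlow (fun r : {r // r ∉ B.routes} => S.links r) v l = 0 := fun l => by
    have := (Finset.sum_eq_zero_iff_of_nonneg fun l _ =>
      mul_nonneg (hα l).le (sq_nonneg _)).1 hsq l (Finset.mem_univ l)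
    exact pow_eq_zero_iff two_ne_zero |>.1 ((mul_eq_zero.1 this).resolve_left (hα l).ne')
  have hv : v = 0 := by
    refine hreg v hlf fun k => ?_
    rw [← bundleMatrix_mulVec_inr α v c k, h0]
    rfl
  have hc : c = 0 := by
    ext k
    obtain ⟨r, rfl⟩ := exists_active hne k
    have := congrFun h0 (Sum.inl r)
    rw [bundleMatrix_mulVec_inl] at this
    simpa [hlf] using this
  subst hv hc
  ext (k | k) <;> rfl

variable (S B) in
/-- The travel cost of each bundle as a function of the bundle totals. -/
noncomputable def bundleCost (α : Link → ℝ) (y : S.Subnetwork B → ℝ) (k : S.Subnetwork B) : ℝ :=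
  ∑ k', S.aggAlpha B α k k' * y k' + S.aggBeta B α k

variable (S B) in
/-- The right-hand side of the bundle equations. -/
def bundleRhs (y : S.Subnetwork B → ℝ) : {r // r ∉ B.routes} ⊕ S.Subnetwork B → ℝ :=
  Sum.elim (fun r => -∑ l ∈ S.links r, S.β l) y

theorem inv_bundleMatrix_mulVec_inr (α : Link → ℝ) (y : S.Subnetwork B → ℝ)
    (k : S.Subnetwork B) :
    (S.bundleMatrix B α)⁻¹.mulVec (S.bundleRhs B y) (Sum.inr k) = S.bundleCost B α y k := by
  rw [Matrix.mulVec, dotProduct, Fintype.sum_sum_type, add_comm, bundleCost, aggBeta,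
    ← Finset.sum_neg_distrib]
  congr 1
  exact Finset.sum_congr rfl fun r _ => by simp [bundleRhs]

theorem bundleMatrix_mulVec_eq_bundleRhs {α : Link → ℝ} {v : {r // r ∉ B.routes} → ℝ}
    {c y : S.Subnetwork B → ℝ}
    (hc : ∀ r, travelCost (fun r : {r // r ∉ B.routes} => S.links r) α S.β v r =
      c (S.activeSub B r))
    (hy : ∀ k, ∑ r, (if S.activeSub B r = k then v r else 0) = y k) :
    (S.bundleMatrix B α).mulVec (Sum.elim v c) = S.bundleRhs B y := by
  ext (r | k)
  · rw [bundleMatrix_mulVec_inl, ← hc r, travelCost, Finset.sum_add_distrib]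
    simp [bundleRhs]
  · rw [bundleMatrix_mulVec_inr, hy]; rfl

/-- If all active routes of each bundle have the same cost, it is the bundle cost. -/
theorem eq_bundleCost {α : Link → ℝ} (hdet : (S.bundleMatrix B α).det ≠ 0)
    {v : {r // r ∉ B.routes} → ℝ} {c y : S.Subnetwork B → ℝ}
    (hc : ∀ r, travelCost (fun r : {r // r ∉ B.routes} => S.links r) α S.β v r =
      c (S.activeSub B r))
    (hy : ∀ k, ∑ r, (if S.activeSub B r = k then v r else 0) = y k) :
    c = S.bundleCost B α y := by
  have h := bundleMatrix_mulVec_eq_bundleRhs hc hy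
  ext k
  rw [← inv_bundleMatrix_mulVec_inr, ← h, Matrix.mulVec_mulVec,
    Matrix.nonsing_inv_mul _ hdet.isUnit, Matrix.one_mulVec]
  rfl

variable (S B) in
/-- The flow on the active routes at which the routes of each bundle have equal costs. -/
noncomputable def bundleFlow (α : Link → ℝ) (y : S.Subnetwork B → ℝ)
    (r : {r // r ∉ B.routes}) : ℝ :=
  (S.bundleMatrix B α)⁻¹.mulVec (S.bundleRhs B y) (Sum.inl r)

theorem bundleMatrix_mulVec_bundleFlow {α : Link → ℝ} (hdet : (S.bundleMatrix B α).det ≠ 0)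
    (y : S.Subnetwork B → ℝ) :
    (S.bundleMatrix B α).mulVec (Sum.elim (S.bundleFlow B α y) (S.bundleCost B α y)) =
      S.bundleRhs B y := by
  have : Sum.elim (S.bundleFlow B α y) (S.bundleCost B α y) =
      (S.bundleMatrix B α)⁻¹.mulVec (S.bundleRhs B y) := by
    ext (r | k)
    · rfl
    · exact (inv_bundleMatrix_mulVec_inr α y k).symm
  rw [this, Matrix.mulVec_mulVec, Matrix.mul_nonsing_inv _ hdet.isUnit, Matrix.one_mulVec]

theorem travelCost_bundleFlow {α : Link → ℝ} (hdet : (S.bundleMatrix B α).det ≠ 0)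
    (y : S.Subnetwork B → ℝ) (r : {r // r ∉ B.routes}) :
    travelCost (fun r : {r // r ∉ B.routes} => S.links r) α S.β (S.bundleFlow B α y) r =
      S.bundleCost B α y (S.activeSub B r) := by
  have := congrFun (bundleMatrix_mulVec_bundleFlow hdet y) (Sum.inl r)
  rw [bundleMatrix_mulVec_inl] at this
  simp only [bundleRhs, Sum.elim_inl] at this
  rw [travelCost, Finset.sum_add_distrib]
  linarith

theorem sum_bundleFlow {α : Link → ℝ} (hdet : (S.bundleMatrix B α).det ≠ 0)
    (y : S.Subnetwork B → ℝ) (k : S.Subnetwork B) :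
    ∑ r, (if S.activeSub B r = k then S.bundleFlow B α y r else 0) = y k := by
  have := congrFun (bundleMatrix_mulVec_bundleFlow hdet y) (Sum.inr k)
  rwa [bundleMatrix_mulVec_inr] at this

theorem bundleFlow_eq {α : Link → ℝ} (hdet : (S.bundleMatrix B α).det ≠ 0)
    {v : {r // r ∉ B.routes} → ℝ} {c y : S.Subnetwork B → ℝ}
    (hc : ∀ r, travelCost (fun r : {r // r ∉ B.routes} => S.links r) α S.β v r =
      c (S.activeSub B r))
    (hy : ∀ k, ∑ r, (if S.activeSub B r = k then v r else 0) = y k) :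
    S.bundleFlow B α y = v := by
  have h := bundleMatrix_mulVec_eq_bundleRhs hc hy
  ext r
  rw [bundleFlow, ← h, Matrix.mulVec_mulVec, Matrix.nonsing_inv_mul _ hdet.isUnit,
    Matrix.one_mulVec]
  rfl

/-- The label of the blocks of the bundle matrix. -/
def blockLabel (i : {r // r ∉ B.routes} ⊕ S.Subnetwork B) : S.Subnetwork B :=
  Sum.elim (S.activeSub B) id i

omit [Fintype Route] [Fintype Bus] in
theorem mem_bundle (r : {r // r ∉ B.routes}) : (r : Route) ∈ S.bundle B (S.activeSub B r) :=
  ⟨r.2, rfl⟩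

omit [Fintype Route] [Fintype Bus] in
theorem bundleMatrix_eq_zero
    (hA2 : ∀ k k', k ≠ k' → Disjoint (S.bundleLinks B k) (S.bundleLinks B k')) (α : Link → ℝ)
    (i j : {r // r ∉ B.routes} ⊕ S.Subnetwork B)
    (hij : blockLabel (S := S) i ≠ blockLabel (S := S) j) :
    S.bundleMatrix B α i j = 0 := by
  rcases i with r | k <;> rcases j with r' | k'
  · change ∑ l ∈ S.links r ∩ S.links r', α l = 0
    refine Finset.sum_eq_zero fun l hl => ?_
    rw [Finset.mem_inter] at hl
    exact (Set.disjoint_left.1 (hA2 _ _ hij) ⟨r, mem_bundle r, hl.1⟩ ⟨r', mem_bundle r', hl.2⟩).elim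
  · change (if S.activeSub B r = k' then (-1 : ℝ) else 0) = 0
    exact if_neg hij
  · change (if S.activeSub B r' = k then (1 : ℝ) else 0) = 0
    exact if_neg (Ne.symm hij)
  · rfl

theorem aggAlpha_eq_zero
    (hA2 : ∀ k k', k ≠ k' → Disjoint (S.bundleLinks B k) (S.bundleLinks B k')) {α : Link → ℝ}
    (hdet : (S.bundleMatrix B α).det ≠ 0) {k k' : S.Subnetwork B} (h : k ≠ k') :
    S.aggAlpha B α k k' = 0 :=
  Matrix.inv_apply_eq_zero_of_blockDiagonal blockLabel (bundleMatrix_eq_zero hA2 α) hdet h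

theorem aggAlpha_self_nonneg [Fintype Link] {α : Link → ℝ} (hα : ∀ l, 0 < α l)
    (hdet : (S.bundleMatrix B α).det ≠ 0) (k : S.Subnetwork B) : 0 ≤ S.aggAlpha B α k k := by
  have hM : (S.bundleMatrix B α).mulVec (Sum.elim
      (fun r => (S.bundleMatrix B α)⁻¹ (Sum.inl r) (Sum.inr k))
      (fun k' => S.aggAlpha B α k' k)) = Sum.elim (fun _ => 0) (Pi.single k 1) := by
    have h1 : (Sum.elim (fun r => (S.bundleMatrix B α)⁻¹ (Sum.inl r) (Sum.inr k))
        (fun k' => S.aggAlpha B α k' k)) = fun i => (S.bundleMatrix B α)⁻¹ i (Sum.inr k) := by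
      ext (r | k) <;> rfl
    have h2 := Matrix.mul_nonsing_inv (S.bundleMatrix B α) hdet.isUnit
    rw [h1]
    ext i
    have h3 := congrFun (congrFun h2 i) (Sum.inr k)
    rw [Matrix.mul_apply] at h3
    rw [Matrix.mulVec, dotProduct, h3]
    rcases i with r | k'
    · simp
    · simp [Matrix.one_apply, Pi.single_apply]
  have h := sum_sq_linkFlow_eq hM
  simp only [Pi.single_apply, mul_ite, mul_one, mul_zero, Finset.sum_ite_eq', Finset.mem_univ,
    if_true] at h
  rw [← h]
  exact Finset.sum_nonneg fun l _ => mul_nonneg (hα l).le (sq_nonneg _)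

/-- The cost coefficients of a bundle depend on the links of this bundle only. -/
theorem inv_bundleMatrix_congr
    (hA2 : ∀ k k', k ≠ k' → Disjoint (S.bundleLinks B k) (S.bundleLinks B k')) {α α' : Link → ℝ}
    (hdet : (S.bundleMatrix B α).det ≠ 0) (hdet' : (S.bundleMatrix B α').det ≠ 0)
    {k : S.Subnetwork B} (h : ∀ l ∈ S.bundleLinks B k, α l = α' l)
    (j : {r // r ∉ B.routes} ⊕ S.Subnetwork B) :
    (S.bundleMatrix B α)⁻¹ (Sum.inr k) j = (S.bundleMatrix B α')⁻¹ (Sum.inr k) j := by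
  refine Matrix.inv_row_congr_of_blockDiagonal blockLabel (bundleMatrix_eq_zero hA2 α) hdet hdet'
    (fun i j hi => ?_) j
  rcases i with r | k' <;> rcases j with r' | k''
  · refine Finset.sum_congr rfl fun l hl => h l ⟨r, ?_, (Finset.mem_inter.1 hl).1⟩
    have := mem_bundle (S := S) r
    rwa [show S.activeSub B r = k from hi] at this
  all_goals rfl

theorem differentiableAt_inv_bundleMatrix {α : Link → ℝ} (hdet : (S.bundleMatrix B α).det ≠ 0)
    (l : Link) (i j : {r // r ∉ B.routes} ⊕ S.Subnetwork B) :
    DifferentiableAt ℝ (fun t => (S.bundleMatrix B (Function.update α l t))⁻¹ i j) (α l) := by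
  refine differentiableAt_inv_apply (fun i j => ?_) (by rwa [Function.update_eq_self]) i j
  rcases i with r | k' <;> rcases j with r' | k''
  · change DifferentiableAt ℝ
      (fun t => ∑ l' ∈ S.links r ∩ S.links r', Function.update α l t l') (α l)
    refine DifferentiableAt.fun_sum fun l' _ => ?_
    by_cases h : l' = l
    · subst h; simp
    · simp [Function.update_of_ne h]
  all_goals exact differentiableAt_const _

end BundleMatrix

end CoupledSystem

namespace CoupledSystem

variable {Route Link Charger Bus Limit : Type*} [Fintype Route] [Fintype Bus]
  {S : CoupledSystem Route Link Charger Bus Limit} {B : BindingPattern Route Limit}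

/-! ### Aggregation of equilibria -/

section Aggregation

omit [Fintype Bus] in
theorem aggFlow_eq_sum_active (x : Route → ℝ) (k : S.Subnetwork B) :
    S.aggFlow B x k =
      ∑ r : {r // r ∉ B.routes}, if S.activeSub B r = k then x r else 0 := by
  have h1 : S.aggFlow B x k = ∑ r, if r ∈ S.bundle B k then x r else 0 := by
    rw [sum_eq_sum_subtype_of_forall (P := fun r => r ∈ S.bundle B k) fun r hr => if_neg hr]
    exact Finset.sum_congr rfl fun r _ => (if_pos r.2).symm
  rw [h1, sum_eq_sum_subtype_of_forall (P := fun r => r ∉ B.routes)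
    fun r hr => if_neg fun h => hr h.1]
  refine Finset.sum_congr rfl fun r _ => if_congr ⟨fun h => h.2, fun h => ⟨r.2, h⟩⟩ rfl rfl

omit [Fintype Bus] in
theorem sum_indicator_mul_eq_aggFlow {x : Route → ℝ} (hx : ∀ r ∈ B.routes, x r = 0)
    (k : S.Subnetwork B) :
    ∑ r, (if S.sub B (S.bus r) = k then 1 else 0) * x r = S.aggFlow B x k := by
  rw [aggFlow_eq_sum_active, sum_eq_sum_subtype_of_forall (P := fun r => r ∉ B.routes)
    fun r hr => by rw [hx r (not_not.1 hr), mul_zero]]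
  exact Finset.sum_congr rfl fun r _ => by
    change (if S.activeSub B r = k then (1 : ℝ) else 0) * _ = _
    split_ifs <;> simp

theorem sum_aggFlow {x : Route → ℝ} (hx : ∀ r ∈ B.routes, x r = 0) :
    ∑ k, S.aggFlow B x k = ∑ r, x r := by
  have h := sum_comp_fiberwise (fun r => S.sub B (S.bus r)) (fun _ => 1) x
  simp only [one_mul] at h
  rw [h]
  refine Finset.sum_congr rfl fun k _ => ?_
  rw [← sum_indicator_mul_eq_aggFlow hx]
  exact Finset.sum_congr rfl fun r _ => by split_ifs <;> simp

omit [Fintype Route] in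
theorem aggQ_pos (k : S.Subnetwork B) : 0 < S.aggQ B k := by
  obtain ⟨i, rfl⟩ := S.sub_surjective B k
  refine inv_pos.2 (Finset.sum_pos' (fun j _ => ?_) ⟨i, Finset.mem_univ i, ?_⟩)
  · split_ifs
    · exact (inv_pos.2 (S.Q_pos j)).le
    · exact le_rfl
  · simpa using S.Q_pos i

variable [Fintype Link] [Fintype Limit] {α : Link → ℝ} {fbar : Limit → ℝ} {x : Route → ℝ}
  {g p : Bus → ℝ}

/-- If the solution of the convex program is unique, shifting traffic among the active routes
without changing link flows and bundle totals is impossible: it would lead to another solution. -/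
theorem IsPatternSolution.bundleRegular (hz : S.IsPatternSolution B α fbar x g p)
    (huniq : ∀ z, S.IsSolution α fbar z → z = (x, g, p)) : S.BundleRegular B := by
  intro v hlf hv
  -- the extension of `v` by zero is a feasible direction along which the objective is constant
  set V : Route → ℝ := fun r => if h : r ∉ B.routes then v ⟨r, h⟩ else 0 with hV
  have hVact : ∀ r : {r // r ∉ B.routes}, V r = v r := fun r => dif_pos r.2
  have hV0 : ∀ r ∈ B.routes, V r = 0 := fun r hr => dif_neg (not_not.2 hr)
  have hagg : ∀ k, S.aggFlow B V k = 0 := fun k => by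
    rw [aggFlow_eq_sum_active]
    simp only [hVact]
    exact hv k
  have hlfV : ∀ l, linkFlow S.links V l = 0 := by
    intro l
    rw [← hlf l, ← linkFlow_subtype (P := fun r => r ∉ B.routes) S.links
      fun r hr _ => hV0 r (not_not.1 hr)]
    simp only [hVact]
  have hflow : ∀ φ : S.Subnetwork B → ℝ, ∑ i, φ (S.sub B i) * S.load V i = 0 := by
    intro φ
    rw [S.sum_mul_load (fun i => φ (S.sub B i)),
      sum_comp_fiberwise (fun r => S.sub B (S.bus r)) φ V]
    have : ∀ k, (∑ r, if S.sub B (S.bus r) = k then V r else 0) = 0 := fun k => by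
      refine Eq.trans ?_ (hagg k)
      rw [← sum_indicator_mul_eq_aggFlow hV0]
      exact Finset.sum_congr rfl fun r _ => by split_ifs <;> simp
    simp [this]
  have hev := eventually_feasible hz.1.1 hz.2.1 hz.2.2 (dx := V) (dg := fun _ => 0)
    (dp := fun i => -S.load V i) (fun i => by ring)
    (by rw [← sum_aggFlow (S := S) hV0]; simp [hagg])
    (by have := hflow fun _ => 1; simpa using this)
    (fun c hc => by
      have h1 := hflow fun k => S.shiftFactor c (Function.surjInv (S.sub_surjective B) k)
      have h2 : ∀ i, S.shiftFactor c (Function.surjInv (S.sub_surjective B) (S.sub B i)) =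
          S.shiftFactor c i := fun i =>
        shiftFactor_eq_of_sub_eq hc (Function.surjInv_eq (S.sub_surjective B) _)
      simp only [h2] at h1
      simp [flow, h1])
    (fun r hr => (hV0 r hr).ge)
  obtain ⟨s, hs, hs0⟩ := (hev.and self_mem_nhdsWithin).exists
  have hobj := S.objective_add_mul α x V g (fun _ => 0) p (fun i => p i + s * -S.load V i) s
  have h0 : ∑ r, travelCost S.links α S.β x r * V r = 0 := by
    unfold travelCost
    rw [sum_mul_sum_links]
    simp [hlfV]
  rw [h0] at hobj
  simp only [hlfV] at hobj
  have hsol : S.IsSolution α fbar (fun r => x r + s * V r, fun i => g i + s * 0,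
      fun i => p i + s * -S.load V i) := by
    refine ⟨hs, fun z' hz' => ?_⟩
    rw [hobj]
    simpa using hz.1.2 z' hz'
  have heq := congrArg Prod.fst (huniq _ hsol)
  ext r
  have hr := congrFun heq r
  simp only [add_eq_left, mul_eq_zero, hVact] at hr
  exact hr.resolve_left (ne_of_gt hs0)

/-- The marginal generation cost in a subnetwork is that of its aggregated generator, which serves
the loads of the bundle and the exports. -/
theorem IsPatternSolution.marginal_eq_agg (hz : S.IsPatternSolution B α fbar x g p)
    (hS : S.SimpleLimits B) (i : Bus) :
    S.Q i * g i + S.μ i =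
      S.aggQ B (S.sub B i) * S.aggGen B fbar (S.aggFlow B x) (S.sub B i) +
        S.aggMu B (S.sub B i) := by
  set k := S.sub B i with hk
  have hgen : ∑ j, (if S.sub B j = k then 1 else 0) * g j = S.aggGen B fbar (S.aggFlow B x) k := by
    have hbal := hz.1.1.1.1
    have hp0 := hz.1.1.1.2.1
    simp only at hbal hp0
    have h1 : ∀ j, g j = S.load x j + p j := fun j => by linarith [hbal j]
    simp only [h1, mul_add, Finset.sum_add_distrib, aggGen]
    congr 1
    · rw [S.sum_mul_load (fun j => if S.sub B j = k then 1 else 0),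
        sum_indicator_mul_eq_aggFlow fun r hr => (hz.2.2 r).1 hr]
    · -- the net injection of `k` is the signed sum of the flows on the congested lines at `k`
      obtain ⟨C, hC⟩ := exists_const_add_shiftFactor hS
        (fun j => if S.sub B j = k then 1 else 0) (fun j j' h => by simp only [h])
      have h2 : ∀ j, (if S.sub B j = k then 1 else 0) * p j = C * p j + ∑ c, (if c ∈ B.limits then
          (if S.sub B (S.tail c) = k then 1 else 0) - (if S.sub B (S.head c) = k then 1 else 0)
          else 0) * S.shiftFactor c j * p j := fun j => by
        rw [← Finset.sum_mul, ← add_mul]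
        exact congrArg (· * p j) (hC j)
      rw [Finset.sum_congr rfl fun j _ => h2 j, Finset.sum_add_distrib, ← Finset.mul_sum, hp0,
        mul_zero, zero_add, Finset.sum_comm, aggExport]
      refine Finset.sum_congr rfl fun c _ => ?_
      simp only [mul_assoc, ← Finset.mul_sum]
      change _ * S.flow p c = _
      by_cases hc : c ∈ B.limits
      · simp only [hc, if_true, ← (hz.2.1 c).1 hc, sub_mul, ite_mul, one_mul, zero_mul]
      · simp [hc]
  have hloc : ∀ j, (if S.sub B j = k then 1 else 0) * g j =
      (S.Q i * g i + S.μ i) * (if S.sub B j = k then (S.Q j)⁻¹ else 0) -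
        if S.sub B j = k then (S.Q j)⁻¹ * S.μ j else 0 := by
    intro j
    split_ifs with h
    · rw [← hz.marginal_eq h]
      have := (S.Q_pos j).ne'
      field_simp
      ring
    · ring
  have hinv : (S.aggQ B k)⁻¹ = ∑ j, if S.sub B j = k then (S.Q j)⁻¹ else 0 := inv_inv _
  rw [← hgen, aggMu, ← mul_add, Finset.sum_congr rfl fun j _ => hloc j, Finset.sum_sub_distrib,
    ← Finset.mul_sum, ← hinv]
  have := (aggQ_pos k).ne'
  field_simp
  ring

omit [Fintype Limit] in
theorem IsPatternSolution.linkFlow_active (hz : S.IsPatternSolution B α fbar x g p) (l : Link) :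
    linkFlow (fun r : {r // r ∉ B.routes} => S.links r) (fun r => x r) l = linkFlow S.links x l :=
  linkFlow_subtype S.links fun r hr _ => (hz.2.2 r).1 (not_not.1 hr)

omit [Fintype Limit] in
theorem IsPatternSolution.travelCost_active (hz : S.IsPatternSolution B α fbar x g p)
    (r : {r // r ∉ B.routes}) :
    travelCost (fun r : {r // r ∉ B.routes} => S.links r) α S.β (fun r => x r) r =
      travelCost S.links α S.β x r := by
  simp only [travelCost, hz.linkFlow_active]

omit [Fintype Limit] in
theorem IsPatternSolution.pos (hz : S.IsPatternSolution B α fbar x g p)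
    (r : {r // r ∉ B.routes}) : 0 < x r :=
  lt_of_le_of_ne (hz.1.1.2.2 r) fun h => r.2 ((hz.2.2 r).2 h.symm)

/-- At equilibrium, the travel cost of an active route is that of its bundle, and the bundle totals
balance the aggregated system. -/
theorem IsPatternSolution.isBalanced (hz : S.IsPatternSolution B α fbar x g p)
    (hS : S.SimpleLimits B) (hne : ∀ k, (S.bundle B k).Nonempty)
    (hdet : (S.bundleMatrix B α).det ≠ 0) :
    (∀ r : {r // r ∉ B.routes}, travelCost S.links α S.β x r =
      S.bundleCost B α (S.aggFlow B x) (S.activeSub B r)) ∧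
    ∃ ν, IsBalanced S.ρ (S.aggQ B) (S.aggMu B) (S.aggAlpha B α) (S.aggBeta B α)
      (S.aggExport B fbar) (S.aggFlow B x) ν := by
  obtain ⟨i₀⟩ := S.isTree.connected.nonempty
  obtain ⟨r₀, -⟩ := exists_active hne (S.sub B i₀)
  set ν := S.routeCost α x (fun i => S.Q i * g i + S.μ i) r₀ with hν
  set L : S.Subnetwork B → ℝ := fun k =>
    S.aggQ B k * S.aggGen B fbar (S.aggFlow B x) k + S.aggMu B k with hL
  have hcost : ∀ r : {r // r ∉ B.routes}, travelCost S.links α S.β x r =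
      ν - S.ρ * L (S.activeSub B r) := by
    intro r
    have h1 := hz.routeCost_le (hz.pos r) (r' := r₀)
    have h2 := hz.routeCost_le (hz.pos r₀) (r' := r)
    have h3 := le_antisymm h1 h2
    have h4 : S.Q (S.bus r) * g (S.bus r) + S.μ (S.bus r) = L (S.activeSub B r) :=
      hz.marginal_eq_agg hS _
    rw [← hν, routeCost, h4] at h3
    linarith
  have hc : (fun k => ν - S.ρ * L k) = S.bundleCost B α (S.aggFlow B x) :=
    eq_bundleCost hdet (v := fun r => x r)
      (fun r => by rw [hz.travelCost_active, hcost]) fun k => (aggFlow_eq_sum_active x k).symm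
  refine ⟨fun r => by rw [← hc, hcost], ν, fun k => ?_, ?_⟩
  · have := congrFun hc k
    simp only [bundleCost, hL, aggGen] at this
    linarith
  · rw [sum_aggFlow fun r hr => (hz.2.2 r).1 hr]
    exact hz.1.1.2.1

variable (S B) in
/-- The part of the generation costs that the aggregation does not see. -/
noncomputable def costOffset : Sector → ℝ
  | Sector.T => 0
  | Sector.P => ∑ k, S.aggMu B k ^ 2 / (2 * S.aggQ B k) - ∑ i, S.μ i ^ 2 / (2 * S.Q i)

/-- The social costs of the coupled system are those of the aggregated system, up to a constant. -/
theorem socialCost_eq (hS : S.SimpleLimits B) (hne : ∀ k, (S.bundle B k).Nonempty)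
    (hdet : (S.bundleMatrix B α).det ≠ 0) (hmem : (α, fbar) ∈ S.criticalRegion B) (s : Sector) :
    S.socialCost s α fbar = systemCost S.ρ (S.aggQ B) (S.aggMu B) s (S.aggAlpha B α)
      (S.aggBeta B α) (S.aggExport B fbar) (S.aggFlow B (S.gueFlow α fbar)) + S.costOffset B s := by
  obtain ⟨g, p, hz, -⟩ := gueFlow_eq hS hmem
  set x := S.gueFlow α fbar with hx
  cases s
  · have h1 : S.socialCost Sector.T α fbar = ∑ r, x r * travelCost S.links α S.β x r := rfl
    rw [h1, sum_eq_sum_subtype_of_forall (P := fun r => r ∉ B.routes)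
      fun r hr => by rw [(hz.2.2 r).1 (not_not.1 hr), zero_mul]]
    simp only [(hz.isBalanced hS hne hdet).1, systemCost, costOffset, add_zero]
    simp only [mul_comm (x _)]
    rw [sum_comp_fiberwise]
    refine Finset.sum_congr rfl fun k _ => ?_
    rw [aggFlow_eq_sum_active x k, mul_comm, ← aggFlow_eq_sum_active, bundleCost]
  · have h1 : S.socialCost Sector.P α fbar = S.dispatchValue fbar x := rfl
    rw [h1, hz.dispatchValue_eq]
    set L : S.Subnetwork B → ℝ := fun k =>
      S.aggQ B k * S.aggGen B fbar (S.aggFlow B x) k + S.aggMu B k with hL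
    have h2 : S.genCost g = ∑ i, L (S.sub B i) ^ 2 / 2 * (S.Q i)⁻¹ -
        ∑ i, S.μ i ^ 2 / (2 * S.Q i) := by
      rw [genCost, ← Finset.sum_sub_distrib]
      refine Finset.sum_congr rfl fun i _ => ?_
      have h3 : L (S.sub B i) = S.Q i * g i + S.μ i := (hz.marginal_eq_agg hS i).symm
      rw [h3]
      have := (S.Q_pos i).ne'
      field_simp
      ring
    rw [h2, sum_comp_fiberwise (S.sub B) (fun k => L k ^ 2 / 2)]
    simp only [systemCost, costOffset]
    rw [← add_sub_assoc, ← Finset.sum_add_distrib]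
    congr 1
    refine Finset.sum_congr rfl fun k _ => ?_
    have hinv : (S.aggQ B k)⁻¹ = ∑ j, if S.sub B j = k then (S.Q j)⁻¹ else 0 := inv_inv _
    rw [← hinv]
    have := (aggQ_pos k).ne'
    simp only [hL, aggGen]
    field_simp
    ring

omit [Fintype Limit] in
/-- The total classical cost in a bundle, if the flow that equalizes its costs is positive. -/
theorem classicalCost_bundle_eq
    (hA2 : ∀ k k', k ≠ k' → Disjoint (S.bundleLinks B k) (S.bundleLinks B k'))
    (hα : ∀ l, 0 < α l) (hdet : (S.bundleMatrix B α).det ≠ 0) (y : S.Subnetwork B → ℝ)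
    (hpos : ∀ r, 0 < S.bundleFlow B α y r) (k : S.Subnetwork B) :
    classicalCost (fun r : S.bundle B k => S.links r) α S.β (y k) =
      y k * S.bundleCost B α y k := by
  set V : Route → ℝ := fun r => if h : r ∉ B.routes then S.bundleFlow B α y ⟨r, h⟩ else 0 with hV
  have hVact : ∀ r : {r // r ∉ B.routes}, V r = S.bundleFlow B α y r := fun r => dif_pos r.2
  have hV0 : ∀ r ∈ B.routes, V r = 0 := fun r hr => dif_neg (not_not.2 hr)
  have hlf : ∀ l ∈ S.bundleLinks B k,
      linkFlow (fun r : S.bundle B k => S.links r) (fun r => V r) l =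
        linkFlow (fun r : {r // r ∉ B.routes} => S.links r) (S.bundleFlow B α y) l := by
    intro l hl
    have h1 := linkFlow_subtype (P := fun r => r ∈ S.bundle B k) S.links (x := V) (l := l)
      fun r hr hlr => by
        by_contra hVr
        have hact : r ∉ B.routes := fun h => hVr (hV0 r h)
        have hkk : k ≠ S.sub B (S.bus r) := fun h => hr ⟨hact, h.symm⟩
        exact Set.disjoint_left.1 (hA2 _ _ hkk) hl ⟨r, ⟨hact, rfl⟩, hlr⟩
    have h2 := linkFlow_subtype (P := fun r => r ∉ B.routes) S.links (x := V) (l := l)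
      fun r hr _ => hV0 r (not_not.1 hr)
    simp only [hVact] at h2
    exact h1.trans h2.symm
  have hcost : ∀ r : S.bundle B k,
      travelCost (fun r : S.bundle B k => S.links r) α S.β (fun r => V r) r =
        S.bundleCost B α y k := by
    rintro ⟨r, hr⟩
    have h1 := travelCost_bundleFlow hdet y ⟨r, hr.1⟩
    rw [show S.activeSub B ⟨r, hr.1⟩ = k from hr.2] at h1
    rw [← h1]
    exact Finset.sum_congr rfl fun l hl => by rw [hlf l ⟨r, hr, hl⟩]
  have hsum : ∑ r : S.bundle B k, V r = y k := by
    have h1 : S.aggFlow B V k = y k := by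
      rw [aggFlow_eq_sum_active]
      simp only [hVact]
      exact sum_bundleFlow hdet y k
    exact h1
  have hW : IsWardrop (y k)
      (travelCost (fun r : S.bundle B k => S.links r) α S.β fun r => V r) (fun r => V r) := by
    refine ⟨fun r => ?_, hsum, fun r _ r' => by rw [hcost, hcost]⟩
    have := hpos ⟨r, r.2.1⟩
    rw [← hVact] at this
    exact this.le
  rw [hW.classicalCost_eq hα]
  simp only [hcost]
  rw [← Finset.mul_sum, hsum, mul_comm]

end Aggregation

end CoupledSystem

/-! ### Derivatives of the social costs -/

theorem partialNeg_iff {ι : Type*} {F : (ι → ℝ) → ℝ} {v : ι → ℝ} {i : ι} {d : ℝ}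
    (h : HasDerivAt (fun t => F (Function.update v i t)) d (v i)) : PartialNeg F v i ↔ d < 0 :=
  ⟨fun ⟨_, hd, h'⟩ => h.unique h' ▸ hd, fun hd => ⟨d, hd, h⟩⟩

theorem partialPos_iff {ι : Type*} {F : (ι → ℝ) → ℝ} {v : ι → ℝ} {i : ι} {d : ℝ}
    (h : HasDerivAt (fun t => F (Function.update v i t)) d (v i)) : PartialPos F v i ↔ 0 < d :=
  ⟨fun ⟨_, hd, h'⟩ => h.unique h' ▸ hd, fun hd => ⟨d, hd, h⟩⟩

theorem mul_neg_iff_of_pos {a b : ℝ} (ha : 0 < a) : a * b < 0 ↔ b < 0 := by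
  simp [mul_neg_iff, ha, ha.not_gt]

namespace CoupledSystem

variable {Route Link Charger Bus Limit : Type*} [Fintype Route] [Fintype Link] [Fintype Bus]
  [Fintype Limit] {S : CoupledSystem Route Link Charger Bus Limit} {B : BindingPattern Route Limit}

section Sensitivity

instance instNonemptySubnetwork : Nonempty (S.Subnetwork B) :=
  S.isTree.connected.nonempty.map (S.sub B)

omit [Fintype Limit] in
theorem slope_pos {α : Link → ℝ} (hα : ∀ l, 0 < α l) (hdet : (S.bundleMatrix B α).det ≠ 0)
    (k : S.Subnetwork B) : 0 < S.aggAlpha B α k k + S.ρ ^ 2 * S.aggQ B k :=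
  add_pos_of_nonneg_of_pos (aggAlpha_self_nonneg hα hdet k)
    (mul_pos (pow_pos S.ρ_pos 2) (aggQ_pos k))

/-- Along a path of parameters in the critical region, the equilibrium totals stay balanced, so the
social costs change as in the aggregated system. -/
theorem hasDerivAt_socialCost (hS : S.SimpleLimits B) (hreg : S.BundleRegular B)
    (hne : ∀ k, (S.bundle B k).Nonempty)
    (hA2 : ∀ k k', k ≠ k' → Disjoint (S.bundleLinks B k) (S.bundleLinks B k'))
    {a : ℝ → Link → ℝ} {f : ℝ → Limit → ℝ} {t₀ : ℝ}
    (hmem : ∀ᶠ t in 𝓝 t₀, (a t, f t) ∈ S.criticalRegion B ∧ ∀ l, 0 < a t l)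
    {A' : S.Subnetwork B → S.Subnetwork B → ℝ} {b' e' : S.Subnetwork B → ℝ}
    (hA : ∀ k k', HasDerivAt (fun t => S.aggAlpha B (a t) k k') (A' k k') t₀)
    (hb : ∀ k, HasDerivAt (fun t => S.aggBeta B (a t) k) (b' k) t₀)
    (he : ∀ k, HasDerivAt (fun t => S.aggExport B (f t) k) (e' k) t₀) (s : Sector) :
    HasDerivAt (fun t => S.socialCost s (a t) (f t))
      (systemCostRate S.ρ (S.aggQ B) (S.aggMu B) (fun k => S.aggAlpha B (a t₀) k k)
        (S.aggBeta B (a t₀)) (S.aggExport B (f t₀)) (S.aggFlow B (S.gueFlow (a t₀) (f t₀))) s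
        (fun j => ∑ k', A' j k' * S.aggFlow B (S.gueFlow (a t₀) (f t₀)) k' + b' j) e'
        (trafficResponse (S.omega B (a t₀)) fun j =>
          ∑ k', A' j k' * S.aggFlow B (S.gueFlow (a t₀) (f t₀)) k' + b' j +
            S.ρ * S.aggQ B j * e' j)) t₀ := by
  have hdet₀ := det_bundleMatrix_ne_zero hreg hne hmem.self_of_nhds.2
  have hbal : ∀ᶠ t in 𝓝 t₀, ∃ ν, IsBalanced S.ρ (S.aggQ B) (S.aggMu B) (S.aggAlpha B (a t))
      (S.aggBeta B (a t)) (S.aggExport B (f t)) (S.aggFlow B (S.gueFlow (a t) (f t))) ν := by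
    filter_upwards [hmem] with t ht
    obtain ⟨g, p, hz, -⟩ := gueFlow_eq hS ht.1
    exact (hz.isBalanced hS hne (det_bundleMatrix_ne_zero hreg hne ht.2)).2
  have h := (hasDerivAt_systemCost hA hb he (fun k k' => aggAlpha_eq_zero hA2 hdet₀)
    (slope_pos hmem.self_of_nhds.2 hdet₀) hbal s).add_const (S.costOffset B s)
  refine h.congr_of_eventuallyEq ?_
  filter_upwards [hmem] with t ht
  exact socialCost_eq hS hne (det_bundleMatrix_ne_zero hreg hne ht.2) ht.1 s

omit [Fintype Route] [Fintype Link] in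
/-- Nonnegative balanced traffic is the equilibrium of the aggregated system if its route costs are
strictly monotone. -/
theorem aggGueFlow_eq {fbar : Limit → ℝ} {a : S.Subnetwork B × S.Subnetwork B → ℝ}
    {b y : S.Subnetwork B → ℝ} {ν : ℝ}
    (hbal : IsBalanced S.ρ (S.aggQ B) (S.aggMu B) (fun k k' => a (k, k')) b
      (S.aggExport B fbar) y ν) (hy : ∀ k, 0 ≤ y k)
    (hmono : ∀ x y : S.Subnetwork B → ℝ, x ≠ y → 0 < ∑ k, ((∑ k', a (k, k') * x k' + b k +
          S.ρ * (S.aggQ B k * (S.ρ * x k + S.aggExport B fbar k) + S.aggMu B k)) -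
        (∑ k', a (k, k') * y k' + b k +
          S.ρ * (S.aggQ B k * (S.ρ * y k + S.aggExport B fbar k) + S.aggMu B k))) * (x k - y k)) :
    S.aggGueFlow B fbar a b = y := by
  have hW : IsWardrop 1 (fun k => S.aggTravelCost B a b y k +
      S.ρ * (S.aggQ B k * S.aggGen B fbar y k + S.aggMu B k)) y :=
    ⟨hy, hbal.2, fun r _ r' => ((hbal.1 r).trans (hbal.1 r').symm).le⟩
  have hex : ∃ y, IsWardrop 1 (fun k => S.aggTravelCost B a b y k +
      S.ρ * (S.aggQ B k * S.aggGen B fbar y k + S.aggMu B k)) y := ⟨y, hW⟩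
  exact IsWardrop.eq_of_strictMonotone (C := fun y k => S.aggTravelCost B a b y k +
      S.ρ * (S.aggQ B k * S.aggGen B fbar y k + S.aggMu B k)) hmono
    (Classical.epsilon_spec hex) hW

omit [Fintype Route] [Fintype Link] in
theorem aggSocialCost_eq (s : Sector) (fbar : Limit → ℝ) (a : S.Subnetwork B × S.Subnetwork B → ℝ)
    (b : S.Subnetwork B → ℝ) :
    S.aggSocialCost B fbar s a b = systemCost S.ρ (S.aggQ B) (S.aggMu B) s (fun k k' => a (k, k')) b
      (S.aggExport B fbar) (S.aggGueFlow B fbar a b) := by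
  cases s <;> rfl

variable (S B) in
/-- The rate of change of a social cost of the aggregated system under an exogenous increase of the
travel cost of the bundle `k` at the rate `1`. -/
noncomputable def bundleSensitivity (s : Sector) (α : Link → ℝ) (fbar : Limit → ℝ)
    (y : S.Subnetwork B → ℝ) (k : S.Subnetwork B) : ℝ :=
  systemCostRate S.ρ (S.aggQ B) (S.aggMu B) (fun k => S.aggAlpha B α k k) (S.aggBeta B α)
    (S.aggExport B fbar) y s (fun j => if j = k then 1 else 0) (fun _ => 0)
    (trafficResponse (S.omega B α) fun j => if j = k then 1 else 0)

omit [Fintype Link] in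
theorem systemCostRate_eq_mul_bundleSensitivity (s : Sector) (α : Link → ℝ) (fbar : Limit → ℝ)
    (y : S.Subnetwork B → ℝ) (k : S.Subnetwork B) {τ : S.Subnetwork B → ℝ} {c : ℝ}
    (hτ : ∀ j, τ j = if j = k then c else 0) :
    systemCostRate S.ρ (S.aggQ B) (S.aggMu B) (fun k => S.aggAlpha B α k k) (S.aggBeta B α)
        (S.aggExport B fbar) y s τ (fun _ => 0)
        (trafficResponse (S.omega B α) fun j => τ j + S.ρ * S.aggQ B j * 0) =
      c * S.bundleSensitivity B s α fbar y k := by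
  rw [bundleSensitivity, ← systemCostRate_smul]
  have : τ = fun j => c * if j = k then 1 else 0 := by ext j; rw [hτ]; simp
  simp only [this, mul_zero, add_zero]

variable {α : Link → ℝ} {fbar : Limit → ℝ} {y : S.Subnetwork B → ℝ}

omit [Fintype Link] in
/-- The social costs of the aggregated system change with its coefficients through the change of
travel costs at fixed traffic only. -/
theorem hasDerivAt_aggSocialCost {A : ℝ → S.Subnetwork B × S.Subnetwork B → ℝ}
    {b : ℝ → S.Subnetwork B → ℝ} {t₀ : ℝ}
    (hA₀ : ∀ k k', A t₀ (k, k') = S.aggAlpha B α k k') (hb₀ : b t₀ = S.aggBeta B α)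
    (hdiag : ∀ k k', k ≠ k' → S.aggAlpha B α k k' = 0)
    (hpos : ∀ k, 0 < S.aggAlpha B α k k + S.ρ ^ 2 * S.aggQ B k)
    {ν : ℝ} (hbal : IsBalanced S.ρ (S.aggQ B) (S.aggMu B) (S.aggAlpha B α) (S.aggBeta B α)
      (S.aggExport B fbar) y ν) (hy : ∀ k, 0 < y k)
    {p p' : S.Subnetwork B} {u : ℝ} {b' : S.Subnetwork B → ℝ}
    (hA : ∀ t k k', A t (k, k') =
      S.aggAlpha B α k k' + if k = p ∧ k' = p' then u * (t - t₀) else 0)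
    (hb : ∀ k, HasDerivAt (fun t => b t k) (b' k) t₀) (s : Sector) {c : ℝ}
    (hc : ∀ j, (if j = p then u * y p' else 0) + b' j = if j = p then c else 0) :
    HasDerivAt (fun t => S.aggSocialCost B fbar s (A t) (b t))
      (c * S.bundleSensitivity B s α fbar y p) t₀ := by
  have hcurry : (fun k k' => A t₀ (k, k')) = S.aggAlpha B α := by ext k k'; exact hA₀ k k'
  have hA' : ∀ k k', HasDerivAt (fun t => A t (k, k')) (if k = p ∧ k' = p' then u else 0) t₀ := by
    intro k k'
    simp only [hA]
    split_ifs
    · simpa using ((((hasDerivAt_id t₀).sub_const t₀).const_mul u).const_add (S.aggAlpha B α k k'))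
    · simpa using hasDerivAt_const t₀ (S.aggAlpha B α k k' + 0)
  have he : ∀ k, HasDerivAt (fun _ : ℝ => S.aggExport B fbar k) 0 t₀ := fun k =>
    hasDerivAt_const _ _
  have hdiag₀ : ∀ k k', k ≠ k' → A t₀ (k, k') = 0 := fun k k' h => by rw [hA₀, hdiag k k' h]
  have hpos₀ : ∀ k, 0 < A t₀ (k, k) + S.ρ ^ 2 * S.aggQ B k := fun k => by rw [hA₀]; exact hpos k
  have hbal₀ : IsBalanced S.ρ (S.aggQ B) (S.aggMu B) (fun k k' => A t₀ (k, k')) (b t₀)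
      (S.aggExport B fbar) y ν := by rw [hcurry, hb₀]; exact hbal
  obtain ⟨δ, hδ, hmono⟩ := exists_strictMonotone hdiag hpos
  have hsmall : ∀ᶠ t in 𝓝 t₀, |u * (t - t₀)| < δ := by
    have hcont : Continuous fun t : ℝ => |u * (t - t₀)| := by fun_prop
    exact hcont.continuousAt.eventually (gt_mem_nhds (by simpa using hδ))
  have hev : ∀ᶠ t in 𝓝 t₀, ∃ ν, IsBalanced S.ρ (S.aggQ B) (S.aggMu B) (fun k k' => A t (k, k'))
      (b t) (S.aggExport B fbar) (S.aggGueFlow B fbar (A t) (b t)) ν := by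
    filter_upwards [hsmall, exists_isBalanced_pos (A := fun t k k' => A t (k, k')) hA' hb he
      hdiag₀ hpos₀ hbal₀ hy] with t ht hex
    obtain ⟨z, ν', hz, hzpos⟩ := hex
    refine ⟨ν', ?_⟩
    rw [aggGueFlow_eq hz (fun k => (hzpos k).le)]
    · exact hz
    · intro x y hxy
      simp only [hA]
      exact hmono p p' _ ht _ _ x y hxy
  have hy₀ : S.aggGueFlow B fbar (A t₀) (b t₀) = y := by
    refine aggGueFlow_eq hbal₀ (fun k => (hy k).le) fun x y hxy => ?_
    simp only [hA]
    exact hmono p p' _ hsmall.self_of_nhds _ _ x y hxy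
  have h := hasDerivAt_systemCost (A := fun t k k' => A t (k, k')) hA' hb he hdiag₀ hpos₀ hev s
  simp only [aggSocialCost_eq]
  refine h.congr_deriv ?_
  simp only [hy₀]
  simp only [hA₀, hb₀]
  refine systemCostRate_eq_mul_bundleSensitivity s α fbar y p fun j => ?_
  rw [← hc j]
  congr 1
  by_cases h : j = p <;> simp [h]

section

variable (hdiag : ∀ k k', k ≠ k' → S.aggAlpha B α k k' = 0)
    (hpos : ∀ k, 0 < S.aggAlpha B α k k + S.ρ ^ 2 * S.aggQ B k)
    {ν : ℝ} (hbal : IsBalanced S.ρ (S.aggQ B) (S.aggMu B) (S.aggAlpha B α) (S.aggBeta B α)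
      (S.aggExport B fbar) y ν) (hy : ∀ k, 0 < y k)
include hdiag hpos hbal hy

omit [Fintype Link] in
theorem hasDerivAt_aggSocialCost_alpha (dec : DecidableEq (S.Subnetwork B × S.Subnetwork B))
    (s : Sector) (k k' : S.Subnetwork B) :
    HasDerivAt (fun t => S.aggSocialCost B fbar s
      (Function.update (fun q : S.Subnetwork B × S.Subnetwork B => S.aggAlpha B α q.1 q.2)
        (k, k') t) (S.aggBeta B α)) (y k' * S.bundleSensitivity B s α fbar y k)
      (S.aggAlpha B α k k') := by
  refine hasDerivAt_aggSocialCost (p := k) (p' := k') (u := 1) (b' := fun _ => 0)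
    (b := fun _ => S.aggBeta B α) (c := y k') (fun p p' => ?_) rfl hdiag
    hpos hbal hy (fun t p p' => ?_) (fun _ => hasDerivAt_const _ _) s (by simp)
  · by_cases h : (p, p') = (k, k')
    · obtain ⟨rfl, rfl⟩ := Prod.mk.inj h
      simp
    · rw [Function.update_of_ne h]
  · by_cases h : (p, p') = (k, k')
    · obtain ⟨rfl, rfl⟩ := Prod.mk.inj h
      simp
    · rw [Function.update_of_ne h, if_neg fun h' => h (by rw [h'.1, h'.2]), add_zero]

omit [Fintype Link] in
theorem hasDerivAt_aggSocialCost_beta (dec : DecidableEq (S.Subnetwork B))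
    (s : Sector) (k : S.Subnetwork B) :
    HasDerivAt (fun t => S.aggSocialCost B fbar s
      (fun q : S.Subnetwork B × S.Subnetwork B => S.aggAlpha B α q.1 q.2)
        (Function.update (S.aggBeta B α) k t))
      (1 * S.bundleSensitivity B s α fbar y k) (S.aggBeta B α k) := by
  refine hasDerivAt_aggSocialCost (p' := k) (u := 0) (b' := fun j => if j = k then 1 else 0)
    (fun p p' => rfl) (Function.update_eq_self _ _) hdiag
    hpos hbal hy (fun t p p' => by simp) (fun j => ?_) s (by simp)
  by_cases h : j = k
  · subst h
    simpa using hasDerivAt_id' _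
  · simpa [h] using hasDerivAt_const _ _

omit [Fintype Link] in
/-- Since all bundles carry traffic, the sign of one number decides on the aggregated paradox. -/
theorem atbp_iff (s : Sector) (k : S.Subnetwork B) :
    S.ATBP B s α fbar k ↔ S.bundleSensitivity B s α fbar y k < 0 := by
  have h1 := fun k' => partialNeg_iff (v := fun q : S.Subnetwork B × S.Subnetwork B =>
    S.aggAlpha B α q.1 q.2) (i := (k, k'))
    (F := fun a => S.aggSocialCost B fbar s a (S.aggBeta B α))
    (hasDerivAt_aggSocialCost_alpha hdiag hpos hbal hy _ s k k')
  have h2 := partialNeg_iff (hasDerivAt_aggSocialCost_beta hdiag hpos hbal hy _ s k)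
  rw [ATBP, h2, one_mul]
  simp only [h1, mul_neg_iff, hy, (hy _).not_gt, true_and, false_and, or_false,
    exists_const, or_self]

omit [Fintype Link] in
theorem atbpStrictlyNot_iff (s : Sector) (k : S.Subnetwork B) :
    S.ATBPStrictlyNot B s α fbar k ↔ 0 < S.bundleSensitivity B s α fbar y k := by
  have h1 := fun k' => partialPos_iff (v := fun q : S.Subnetwork B × S.Subnetwork B =>
    S.aggAlpha B α q.1 q.2) (i := (k, k'))
    (F := fun a => S.aggSocialCost B fbar s a (S.aggBeta B α))
    (hasDerivAt_aggSocialCost_alpha hdiag hpos hbal hy _ s k k')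
  have h2 := partialPos_iff (hasDerivAt_aggSocialCost_beta hdiag hpos hbal hy _ s k)
  rw [ATBPStrictlyNot, h2, one_mul]
  simp only [h1, mul_pos_iff_of_pos_left (hy _), forall_const, and_self]

end

end Sensitivity

/-! ### Perturbing a road link -/

section RoadLink

variable {α : Link → ℝ}

variable (S B) in
/-- The derivative of the travel cost of the bundle `k` in `α l`, at fixed bundle totals `y`. -/
noncomputable def bundleCostDeriv (α : Link → ℝ) (l : Link) (y : S.Subnetwork B → ℝ)
    (k : S.Subnetwork B) : ℝ :=
  deriv (fun t => S.bundleCost B (Function.update α l t) y k) (α l)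

omit [Fintype Link] [Fintype Limit] in
theorem differentiableAt_aggBeta (hdet : (S.bundleMatrix B α).det ≠ 0) (l : Link)
    (k : S.Subnetwork B) :
    DifferentiableAt ℝ (fun t => S.aggBeta B (Function.update α l t) k) (α l) :=
  (DifferentiableAt.fun_sum fun _ _ =>
    (differentiableAt_inv_bundleMatrix hdet l _ _).mul_const _).neg

omit [Fintype Link] [Fintype Limit] in
theorem differentiableAt_aggAlpha (hdet : (S.bundleMatrix B α).det ≠ 0) (l : Link)
    (k k' : S.Subnetwork B) :
    DifferentiableAt ℝ (fun t => S.aggAlpha B (Function.update α l t) k k') (α l) :=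
  differentiableAt_inv_bundleMatrix hdet l _ _

omit [Fintype Link] [Fintype Limit] in
theorem hasDerivAt_bundleCost (hdet : (S.bundleMatrix B α).det ≠ 0) (l : Link)
    (y : S.Subnetwork B → ℝ) (k : S.Subnetwork B) :
    HasDerivAt (fun t => S.bundleCost B (Function.update α l t) y k)
      (S.bundleCostDeriv B α l y k) (α l) :=
  DifferentiableAt.hasDerivAt <| (DifferentiableAt.fun_sum fun k' _ =>
    (differentiableAt_aggAlpha hdet l k k').mul_const _).add (differentiableAt_aggBeta hdet l k)

omit [Fintype Link] [Fintype Limit] in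
theorem sum_deriv_aggAlpha_add_deriv_aggBeta (hdet : (S.bundleMatrix B α).det ≠ 0) (l : Link)
    (y : S.Subnetwork B → ℝ) (k : S.Subnetwork B) :
    ∑ k', deriv (fun t => S.aggAlpha B (Function.update α l t) k k') (α l) * y k' +
      deriv (fun t => S.aggBeta B (Function.update α l t) k) (α l) = S.bundleCostDeriv B α l y k :=
  ((HasDerivAt.fun_sum fun k' _ =>
    (differentiableAt_aggAlpha hdet l k k').hasDerivAt.mul_const (y k')).add
      (differentiableAt_aggBeta hdet l k).hasDerivAt).unique (hasDerivAt_bundleCost hdet l y k)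

omit [Fintype Link] in
theorem eventually_update_pos (hα : ∀ l, 0 < α l) (l : Link) :
    ∀ᶠ t in 𝓝 (α l), ∀ l', 0 < Function.update α l t l' := by
  filter_upwards [lt_mem_nhds (hα l)] with t ht l'
  by_cases h : l' = l
  · subst h; simpa using ht
  · rw [Function.update_of_ne h]; exact hα l'

omit [Fintype Limit] in
/-- A link outside a bundle does not affect its travel cost. -/
theorem bundleCostDeriv_eq_zero (hreg : S.BundleRegular B) (hne : ∀ k, (S.bundle B k).Nonempty)
    (hA2 : ∀ k k', k ≠ k' → Disjoint (S.bundleLinks B k) (S.bundleLinks B k'))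
    (hα : ∀ l, 0 < α l) {l : Link} (y : S.Subnetwork B → ℝ) {k : S.Subnetwork B}
    (hl : l ∉ S.bundleLinks B k) : S.bundleCostDeriv B α l y k = 0 := by
  have hdet := det_bundleMatrix_ne_zero hreg hne hα
  refine (hasDerivAt_bundleCost hdet l y k).unique
    ((hasDerivAt_const _ (S.bundleCost B α y k)).congr_of_eventuallyEq ?_)
  filter_upwards [eventually_update_pos hα l] with t ht
  have hrow := inv_bundleMatrix_congr hA2 (det_bundleMatrix_ne_zero hreg hne ht) hdet (k := k)
    fun l' hl' => Function.update_of_ne (fun h => hl (by rwa [h] at hl')) _ _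
  simp only [bundleCost, aggAlpha, aggBeta, hrow]

omit [Fintype Limit] in
/-- The positive flow that equalizes the costs of a bundle stays positive under small perturbations
of `α l`, so the classical cost is the bundle cost times the fixed total. -/
theorem hasDerivAt_classicalCost (hreg : S.BundleRegular B) (hne : ∀ k, (S.bundle B k).Nonempty)
    (hA2 : ∀ k k', k ≠ k' → Disjoint (S.bundleLinks B k) (S.bundleLinks B k'))
    (hα : ∀ l, 0 < α l) (l : Link) {y : S.Subnetwork B → ℝ}
    (hpos : ∀ r, 0 < S.bundleFlow B α y r) (k : S.Subnetwork B) :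
    HasDerivAt (fun t => classicalCost (fun r : S.bundle B k => S.links r)
      (Function.update α l t) S.β (y k)) (y k * S.bundleCostDeriv B α l y k) (α l) := by
  have hdet := det_bundleMatrix_ne_zero hreg hne hα
  refine ((hasDerivAt_bundleCost hdet l y k).const_mul (y k)).congr_of_eventuallyEq ?_
  have hflow : ∀ᶠ t in 𝓝 (α l), ∀ r, 0 < S.bundleFlow B (Function.update α l t) y r := by
    refine eventually_all.2 fun r => ?_
    have hd : DifferentiableAt ℝ (fun t => S.bundleFlow B (Function.update α l t) y r) (α l) := by
      simp only [bundleFlow, Matrix.mulVec, dotProduct]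
      exact DifferentiableAt.fun_sum fun j _ =>
        (differentiableAt_inv_bundleMatrix hdet l _ _).mul_const _
    refine hd.continuousAt.eventually (lt_mem_nhds ?_)
    dsimp only
    rw [Function.update_eq_self]
    exact hpos r
  filter_upwards [eventually_update_pos hα l, hflow] with t ht hf
  exact classicalCost_bundle_eq hA2 ht (det_bundleMatrix_ne_zero hreg hne ht) y hf k

omit [Fintype Limit] in
/-- The classical paradox in a bundle is governed by the derivative of its travel cost. -/
theorem classicalBPAt_iff (hreg : S.BundleRegular B) (hne : ∀ k, (S.bundle B k).Nonempty)
    (hA2 : ∀ k k', k ≠ k' → Disjoint (S.bundleLinks B k) (S.bundleLinks B k'))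
    (hα : ∀ l, 0 < α l) (l : Link) {y : S.Subnetwork B → ℝ}
    (hpos : ∀ r, 0 < S.bundleFlow B α y r) {k : S.Subnetwork B} (hy : 0 < y k) :
    S.ClassicalBPAt B α (y k) k l ↔ S.bundleCostDeriv B α l y k < 0 := by
  rw [ClassicalBPAt, partialNeg_iff
    (F := fun a => classicalCost (fun r : S.bundle B k => S.links r) a S.β (y k))
    (hasDerivAt_classicalCost hreg hne hA2 hα l hpos k), mul_neg_iff_of_pos hy]

omit [Fintype Limit] in
theorem classicalBPStrictlyNotAt_iff (hreg : S.BundleRegular B)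
    (hne : ∀ k, (S.bundle B k).Nonempty)
    (hA2 : ∀ k k', k ≠ k' → Disjoint (S.bundleLinks B k) (S.bundleLinks B k'))
    (hα : ∀ l, 0 < α l) (l : Link) {y : S.Subnetwork B → ℝ}
    (hpos : ∀ r, 0 < S.bundleFlow B α y r) {k : S.Subnetwork B} (hy : 0 < y k) :
    S.ClassicalBPStrictlyNotAt B α (y k) k l ↔ 0 < S.bundleCostDeriv B α l y k := by
  rw [ClassicalBPStrictlyNotAt, partialPos_iff
    (F := fun a => classicalCost (fun r : S.bundle B k => S.links r) a S.β (y k))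
    (hasDerivAt_classicalCost hreg hne hA2 hα l hpos k), mul_pos_iff_of_pos_left hy]

end RoadLink

/-! ### Perturbing a flow limit -/

section FlowLimit

variable {α : Link → ℝ} {fbar : Limit → ℝ}

variable (S B) in
/-- The derivative of the exports in a flow limit. -/
noncomputable def exportDeriv (c : Limit) (k : S.Subnetwork B) : ℝ :=
  if c ∈ B.limits then
    (if S.sub B (S.tail c) = k then 1 else 0) - (if S.sub B (S.head c) = k then 1 else 0)
  else 0

omit [Fintype Route] [Fintype Link] [Fintype Bus] in
theorem hasDerivAt_aggExport (c : Limit) (k : S.Subnetwork B) (t₀ : ℝ) :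
    HasDerivAt (fun t => S.aggExport B (Function.update fbar c t) k) (S.exportDeriv B c k) t₀ := by
  have h : ∀ t, S.aggExport B (Function.update fbar c t) k =
      S.exportDeriv B c k * t + S.aggExport B (Function.update fbar c 0) k := by
    intro t
    have h1 : S.exportDeriv B c k * t = ∑ c', if c' = c then S.exportDeriv B c k * t else 0 := by
      simp
    rw [h1, aggExport, aggExport, ← Finset.sum_add_distrib]
    refine Finset.sum_congr rfl fun c' _ => ?_
    by_cases hc : c' = c
    · subst hc
      simp only [exportDeriv, Function.update_self, if_true]
      split_ifs <;> ring
    · simp [hc]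
  rw [funext h]
  simpa using ((hasDerivAt_id t₀).const_mul (S.exportDeriv B c k)).add_const
    (S.aggExport B (Function.update fbar c 0) k)

omit [Fintype Route] [Fintype Link] [Fintype Limit] in
theorem sum_mul_exportDeriv {c : Limit} (hc : c ∈ B.limits) (z : S.Subnetwork B → ℝ) :
    ∑ k, S.exportDeriv B c k * z k = z (S.sub B (S.tail c)) - z (S.sub B (S.head c)) := by
  simp [exportDeriv, hc, sub_mul]

omit [Fintype Link] [Fintype Limit] in
theorem sum_omegaTilde (hpos : ∀ k, 0 < S.aggAlpha B α k k + S.ρ ^ 2 * S.aggQ B k) :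
    ∑ k, S.omegaTilde B α k = 1 := by
  have : 0 < ∑ k, S.omega B α k :=
    Finset.sum_pos (fun k _ => one_div_pos.2 (hpos k)) Finset.univ_nonempty
  simp only [omegaTilde]
  rw [← Finset.sum_div, div_self this.ne']

end FlowLimit

end CoupledSystem

namespace CoupledSystem

variable {Route Link Charger Bus Limit : Type*} [Fintype Route] [Fintype Link] [Fintype Bus]
  [Fintype Limit] {S : CoupledSystem Route Link Charger Bus Limit} {B : BindingPattern Route Limit}

/-! ### Signs of the paradoxes -/

section Interior

variable {α : Link → ℝ} {fbar : Limit → ℝ}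
  (hB : (α, fbar) ∈ interior (S.criticalRegion B)) (hα : ∀ l, 0 < α l)
  (hreg : S.BundleRegular B) (hne : ∀ k, (S.bundle B k).Nonempty)
  (hA2 : ∀ k k', k ≠ k' → Disjoint (S.bundleLinks B k) (S.bundleLinks B k'))
include hB hα hreg hne hA2

/-- A road link acts on the social costs through the travel cost of its bundle. -/
theorem hasDerivAt_socialCost_alpha (s : Sector) {l : Link} {k : S.Subnetwork B}
    (hl : ∀ j, j ≠ k → l ∉ S.bundleLinks B j) :
    HasDerivAt (fun t => S.socialCost s (Function.update α l t) fbar)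
      (S.bundleCostDeriv B α l (S.aggFlow B (S.gueFlow α fbar)) k *
        S.bundleSensitivity B s α fbar (S.aggFlow B (S.gueFlow α fbar)) k) (α l) := by
  have hdet := det_bundleMatrix_ne_zero hreg hne hα
  have hcont : Continuous fun t : ℝ => (Function.update α l t, fbar) := by fun_prop
  have hmem : ∀ᶠ t in 𝓝 (α l), (Function.update α l t, fbar) ∈ S.criticalRegion B :=
    hcont.continuousAt.eventually_mem (by
      rw [Function.update_eq_self]; exact mem_interior_iff_mem_nhds.1 hB)
  have h := hasDerivAt_socialCost (simpleLimits_of_mem_interior hB) hreg hne hA2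
    (f := fun _ => fbar) (hmem.and (eventually_update_pos hα l))
    (fun k k' => (differentiableAt_aggAlpha hdet l k k').hasDerivAt)
    (fun k => (differentiableAt_aggBeta hdet l k).hasDerivAt)
    (fun k => hasDerivAt_const _ _) s
  refine h.congr_deriv ?_
  simp only [Function.update_eq_self, sum_deriv_aggAlpha_add_deriv_aggBeta hdet]
  refine systemCostRate_eq_mul_bundleSensitivity s α fbar _ k fun j => ?_
  split_ifs with hj
  · rw [hj]
  · exact bundleCostDeriv_eq_zero hreg hne hA2 hα _ (hl j hj)

theorem hasDerivAt_socialCost_fbar (s : Sector) (c : Limit) :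
    HasDerivAt (fun t => S.socialCost s α (Function.update fbar c t))
      (systemCostRate S.ρ (S.aggQ B) (S.aggMu B) (fun k => S.aggAlpha B α k k)
        (S.aggBeta B α) (S.aggExport B fbar) (S.aggFlow B (S.gueFlow α fbar)) s
        (fun _ => 0) (S.exportDeriv B c)
        (trafficResponse (S.omega B α) fun j => S.ρ * S.aggQ B j * S.exportDeriv B c j))
      (fbar c) := by
  have hcont : Continuous fun t : ℝ => (α, Function.update fbar c t) := by fun_prop
  have hmem : ∀ᶠ t in 𝓝 (fbar c), (α, Function.update fbar c t) ∈ S.criticalRegion B :=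
    hcont.continuousAt.eventually_mem (by
      rw [Function.update_eq_self]; exact mem_interior_iff_mem_nhds.1 hB)
  have h := hasDerivAt_socialCost (simpleLimits_of_mem_interior hB) hreg hne hA2
    (a := fun _ => α) (hmem.and (Eventually.of_forall fun _ => hα))
    (fun k k' => hasDerivAt_const _ _) (fun k => hasDerivAt_const _ _)
    (fun k => hasDerivAt_aggExport (fbar := fbar) c k _) s
  refine h.congr_deriv ?_
  simp only [Function.update_eq_self, zero_mul, Finset.sum_const_zero, zero_add]

theorem hasDerivAt_socialCost_T_fbar (c : Limit) :
    HasDerivAt (fun t => S.socialCost Sector.T α (Function.update fbar c t))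
      (-S.ρ * ∑ k, S.exportDeriv B c k * (S.aggQ B k * S.psi B α (S.gueFlow α fbar) k))
      (fbar c) := by
  refine (hasDerivAt_socialCost_fbar hB hα hreg hne hA2 Sector.T c).congr_deriv ?_
  simp only [systemCostRate, mul_zero, Finset.sum_const_zero, add_zero]
  rw [sum_mul_trafficResponse, Finset.mul_sum]
  refine Finset.sum_congr rfl fun k _ => ?_
  simp only [trafficResponse, psi, omegaTilde]
  ring

theorem hasDerivAt_socialCost_P_fbar (c : Limit) {lam : Bus → ℝ}
    (hlam : ∀ k, S.aggPrice B lam k =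
      S.aggQ B k * S.aggGen B fbar (S.aggFlow B (S.gueFlow α fbar)) k + S.aggMu B k) :
    HasDerivAt (fun t => S.socialCost Sector.P α (Function.update fbar c t))
      (∑ k, S.exportDeriv B c k * S.varsigma B α lam k) (fbar c) := by
  refine (hasDerivAt_socialCost_fbar hB hα hreg hne hA2 Sector.P c).congr_deriv ?_
  have hprice : ∀ k, S.aggQ B k * (S.ρ * S.aggFlow B (S.gueFlow α fbar) k + S.aggExport B fbar k) +
      S.aggMu B k = S.aggPrice B lam k := fun k => (hlam k).symm
  have hone := sum_omegaTilde (slope_pos hα (det_bundleMatrix_ne_zero hreg hne hα))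
  simp only [systemCostRate, hprice]
  simp only [mul_add, Finset.sum_add_distrib]
  simp only [mul_left_comm _ S.ρ, ← Finset.mul_sum]
  rw [sum_mul_trafficResponse, Finset.mul_sum, ← Finset.sum_add_distrib]
  refine Finset.sum_congr rfl fun k _ => ?_
  have hdiff : ∑ j, S.omegaTilde B α j * (S.aggPrice B lam k - S.aggPrice B lam j) =
      S.aggPrice B lam k - ∑ j, S.omega B α j / (∑ j, S.omega B α j) * S.aggPrice B lam j := by
    simp only [mul_sub, Finset.sum_sub_distrib, ← Finset.sum_mul, hone, one_mul]
    rfl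
  simp only [trafficResponse, varsigma, hdiff]
  ring

end Interior

omit [Fintype Link] [Fintype Bus] [Fintype Limit] in
theorem aggFlow_pos {x : Route → ℝ} (hx : ∀ r : {r // r ∉ B.routes}, 0 < x r)
    {k : S.Subnetwork B} (hne : (S.bundle B k).Nonempty) : 0 < S.aggFlow B x k := by
  obtain ⟨r, hr⟩ := hne
  exact Finset.sum_pos (fun r _ => hx ⟨r, r.2.1⟩) ⟨⟨r, hr⟩, Finset.mem_univ _⟩

end CoupledSystem

end

theorem mainTheorem3 {Route Link Charger Bus Limit : Type*}
    [Fintype Route] [Fintype Link] [Fintype Bus] [Fintype Limit]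
    (S : CoupledSystem Route Link Charger Bus Limit)
    (α : Link → ℝ) (fbar : Limit → ℝ) (hα : ∀ l, 0 < α l) (hf : ∀ c, 0 < fbar c)
    -- the parameters are perturbed inside the critical region of the binding pattern `B`
    (B : BindingPattern Route Limit) (hB : (α, fbar) ∈ interior (S.criticalRegion B))
    (x : Route → ℝ) (lam : Bus → ℝ) (hGUE : S.IsGUE α fbar x lam)
    (hne : ∀ k, (S.bundle B k).Nonempty)
    -- no two route bundles share links
    (hA2 : ∀ k k', k ≠ k' → Disjoint (S.bundleLinks B k) (S.bundleLinks B k')) :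
    -- (a)
    (∀ s : Sector,
      (∀ l, S.TBPAt s α fbar l →
        ∃ k, l ∈ S.bundleLinks B k ∧
          Xor (S.ATBP B s α fbar k) (S.ClassicalBPAt B α (S.aggFlow B x k) k l)) ∧
      (∀ k, ∀ l ∈ S.bundleLinks B k,
        (S.ATBP B s α fbar k ∧ S.ClassicalBPStrictlyNotAt B α (S.aggFlow B x k) k l) ∨
        (S.ATBPStrictlyNot B s α fbar k ∧ S.ClassicalBPAt B α (S.aggFlow B x k) k l) →
        S.TBPAt s α fbar l)) ∧
    -- (b)
    (∀ c, S.PBPAt Sector.T α fbar c ↔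
      c ∈ B.limits ∧
        S.aggQ B (S.sub B (S.tail c)) * S.psi B α x (S.sub B (S.tail c)) -
          S.aggQ B (S.sub B (S.head c)) * S.psi B α x (S.sub B (S.head c)) < 0) ∧
    -- (c)
    (∀ c ∈ B.limits,
      0 < S.varsigma B α lam (S.sub B (S.tail c)) - S.varsigma B α lam (S.sub B (S.head c)) →
        S.PBPAt Sector.P α fbar c) := by
  have hS := CoupledSystem.simpleLimits_of_mem_interior hB
  obtain ⟨g, p, hz, huniq⟩ := CoupledSystem.gueFlow_eq hS (interior_subset hB)
  have hreg := hz.bundleRegular huniq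
  have hdet := CoupledSystem.det_bundleMatrix_ne_zero hreg hne hα
  have hdiag := fun k k' => CoupledSystem.aggAlpha_eq_zero (k := k) (k' := k') hA2 hdet
  have hpos := CoupledSystem.slope_pos hα hdet
  -- the given equilibrium is the one that enters the social costs
  obtain ⟨g', p', hsol, hlam⟩ := hGUE.exists_isSolution fun l => (hα l).le
  obtain ⟨rfl, rfl, rfl⟩ : x = S.gueFlow α fbar ∧ g' = g ∧ p' = p := by
    simpa using huniq _ hsol
  obtain ⟨hcost, ν, hbal⟩ := hz.isBalanced hS hne hdet
  have hy : ∀ k, 0 < S.aggFlow B (S.gueFlow α fbar) k := fun k =>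
    CoupledSystem.aggFlow_pos hz.pos (hne k)
  have hflow : ∀ r, 0 < S.bundleFlow B α (S.aggFlow B (S.gueFlow α fbar)) r := by
    rw [CoupledSystem.bundleFlow_eq hdet (fun r => (hz.travelCost_active r).trans (hcost r))
      fun k => (CoupledSystem.aggFlow_eq_sum_active _ k).symm]
    exact hz.pos
  have hprice : ∀ k, S.aggPrice B lam k =
      S.aggQ B k * S.aggGen B fbar (S.aggFlow B (S.gueFlow α fbar)) k + S.aggMu B k := by
    intro k
    have h := hz.marginal_eq_agg hS (Function.surjInv (S.sub_surjective B) k)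
    rwa [Function.surjInv_eq (S.sub_surjective B), hlam] at h
  have hroad := fun s l k hl =>
    partialNeg_iff (F := fun a => S.socialCost s a fbar)
      (CoupledSystem.hasDerivAt_socialCost_alpha hB hα hreg hne hA2 s (l := l) (k := k) hl)
  have hdisj : ∀ k, ∀ l ∈ S.bundleLinks B k, ∀ j, j ≠ k → l ∉ S.bundleLinks B j :=
    fun k l hl j hj hl' => Set.disjoint_left.1 (hA2 j k hj) hl' hl
  have hclassNeg := fun l k =>
    CoupledSystem.classicalBPAt_iff hreg hne hA2 hα l hflow (hy k)
  have hclassPos := fun l k =>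
    CoupledSystem.classicalBPStrictlyNotAt_iff hreg hne hA2 hα l hflow (hy k)
  refine ⟨fun s => ⟨fun l hl => ?_, fun k l hl h => ?_⟩, fun c => ?_, fun c hc h => ?_⟩
  · by_cases hex : ∃ k, l ∈ S.bundleLinks B k
    · obtain ⟨k, hk⟩ := hex
      refine ⟨k, hk, ?_⟩
      have h := (hroad s l k (hdisj k l hk)).1 hl
      rw [CoupledSystem.atbp_iff hdiag hpos hbal hy, hclassNeg]
      rcases mul_neg_iff.1 h with ⟨h1, h2⟩ | ⟨h1, h2⟩
      · exact Or.inl ⟨h2, h1.not_gt⟩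
      · exact Or.inr ⟨h1, h2.not_gt⟩
    · -- a link outside all bundles has no influence
      exfalso
      push Not at hex
      obtain ⟨k⟩ : Nonempty (S.Subnetwork B) := inferInstance
      have h := (hroad s l k fun j _ => hex j).1 hl
      rw [CoupledSystem.bundleCostDeriv_eq_zero hreg hne hA2 hα _ (hex k), zero_mul] at h
      exact lt_irrefl _ h
  · rw [CoupledSystem.atbp_iff hdiag hpos hbal hy, CoupledSystem.atbpStrictlyNot_iff hdiag hpos hbal
      hy, hclassNeg,
      hclassPos] at h
    refine (hroad s l k (hdisj k l hl)).2 (mul_neg_iff.2 ?_)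
    rcases h with ⟨h1, h2⟩ | ⟨h1, h2⟩
    · exact Or.inl ⟨h2, h1⟩
    · exact Or.inr ⟨h2, h1⟩
  · rw [CoupledSystem.PBPAt, partialPos_iff (F := fun f => S.socialCost Sector.T α f)
      (CoupledSystem.hasDerivAt_socialCost_T_fbar hB hα hreg hne hA2 c)]
    by_cases hc : c ∈ B.limits
    · rw [CoupledSystem.sum_mul_exportDeriv hc, neg_mul, neg_pos,
        mul_neg_iff_of_pos S.ρ_pos]
      simp [hc]
    · simp [CoupledSystem.exportDeriv, hc]
  · refine (partialPos_iff (F := fun f => S.socialCost Sector.P α f)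
      (CoupledSystem.hasDerivAt_socialCost_P_fbar hB hα hreg hne hA2 c hprice)).2 ?_
    rwa [CoupledSystem.sum_mul_exportDeriv hc]
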